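/- **Notation.** For $\alpha,z\in\mathbb R$ let $D_\alpha(z)=U(-\alpha-\tfrac12,z)$ be the parabolic cylinder function $$D_\alpha(z)=\frac{2^{\alpha/2}e^{-z^2/4}}{\sqrt\pi}\Big(\cos\tfrac{\pi\alpha}{2}\,\Gamma\big(\tfrac{\alpha+1}{2}\big)\,{}_1F_1\big(-\tfrac{\alpha}{2};\tfrac12;\tfrac{z^2}{2}\big)+\sqrt2\,z\,\sin\tfrac{\pi\alpha}{2}\,\Gamma\big(\tfrac{\alpha}{2}+1\big)\,{}_1F_1\big(\tfrac12-\tfrac{\alpha}{2};\tfrac32;\tfrac{z^2}{2}\big)\Big),$$ where at the negative integers $\alpha$ the products $\cos\frac{\pi\alpha}{2}\Gamma(\frac{\alpha+1}{2})=\pi/\Gamma(\frac{1-\alpha}{2})$ and $\sin\frac{\pi\alpha}{2}\Gamma(\frac{\alpha}{2}+1)=-\pi/\Gamma(-\frac{\alpha}{2})$ are extended by continuity. For $x\in\mathbb R$, $t>0$ let $$\mathcal H_\alpha(x,t)=t^{\alpha/2}e^{x^2/(4t)}D_\alpha\big(x/\sqrt t\big).$$ Let $\mathcal D'^+$ be the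 set of distributions on $\mathbb R$ vanishing on $(-\infty,0)$, $\mathcal S'^+=\mathcal D'^+\cap\mathcal S'(\mathbb R)$, and for $a\in\mathbb R$ let $\mathcal D'^+_a$ be the set of $g\in\mathcal D'^+$ with $e^{-\xi u}g(u)\in\mathcal S'^+$ for all $\xi>a$. Let $\lambda\in C^\infty(\mathbb R)$ be a cutoff function equal to $1$ in a neighbourhood of $[0,\infty)$ and to $0$ on $(-\infty,-1)$. For $g\in\mathcal S'^+$ and a function $f$ with $\lambda f\in\mathcal S(\mathbb R)$ put $\langle g,f\rangle=\langle g,\lambda f\rangle$. The Laplace transform of $g\in\mathcal D'^+_a$ is $$\mathcal L\{g\}(s)=\langle g(u),e^{-su}\rangle:=\langle e^{-\xi u}g(u),e^{-(s-\xi)u}\rangle,\qquad \operatorname{Re}s>a,$$ for any $\xi\in(a,\operatorname{Re}s)$. For a real random variable $X$ and $g$ with $g(u)/\mathbf E e^{-uX}\in\mathcal D'^+_a$, the Appell integral transform of $G=\mathcal L\{g\}$ with respect to $X$ is $$\mathscr A_X\{G\}(y)=\Big\langle \frac{g(u)}{\mathbf E e^{-uX}},e^{-uy}\Big\rangle,\qquad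 y>a.$$ **Theorem.** Let $\alpha\in\mathbb R$. There is exactly one $g\in\mathcal D'^+_0$ with $\mathcal L\{g\}(s)=s^\alpha$ (principal branch) for all $s$ with $\operatorname{Re}s>0$; write $g=\mathcal L^{-1}\{y^\alpha\}$. Let $W=\{W_t\}_{t\ge0}$ be a Wiener process (standard Brownian motion), $t>0$ and $x\in\mathbb R$. Then $g(u)/\mathbf E e^{-uW_t}$ belongs to $\mathcal D'^+_a$ for every $a<x$, $g$ belongs to $\mathcal S'^+$, and $$\mathcal H_\alpha(x,t)=\mathscr A_{W_t}\{y^\alpha\}(x)=\Big\langle \frac{\mathcal L^{-1}\{y^\alpha\}(u)}{\mathbf E e^{-uW_t}},e^{-ux}\Big\rangle=\Big\langle \mathcal L^{-1}\{y^\alpha\}(u),e^{-ux-\frac{u^2}{2}t}\Big\rangle .$$ -/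

import Mathlib

open MeasureTheory ProbabilityTheory TopologicalSpace
open scoped Distributions SchwartzMap ContDiff NNReal

noncomputable section

/-! ### Power-normalised parabolic cylinder functions -/

/-- Kummer's confluent hypergeometric function `₁F₁(a; b; z) = ∑ (a)_n zⁿ / ((b)_n n!)`
(used only for `b` outside `{0, -1, -2, …}`, where the series converges for every `z`). -/
def kummerM (a b z : ℝ) : ℝ :=
  ∑' n : ℕ, ((ascPochhammer ℝ n).eval a * z ^ n) / ((ascPochhammer ℝ n).eval b * n.factorial)

/-- The parabolic cylinder function `D_α(z) = U(-α - 1/2, z)`.  The coefficients are written with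
the entire function `1 / Γ` (in Mathlib `Real.Gamma` is `0` at its poles, so that
`(Real.Gamma s)⁻¹` is the value of `1 / Γ` for every real `s`).  See
`parabolicCylinderD_eq_cos_sin` for the form with `cos (πα/2) Γ((α+1)/2)` and
`sin (πα/2) Γ(α/2+1)`, which has removable singularities at the negative integers `α`. -/
def parabolicCylinderD (α z : ℝ) : ℝ :=
  (2 : ℝ) ^ (α / 2) * Real.exp (-z ^ 2 / 4) *
    (√Real.pi * (Real.Gamma ((1 - α) / 2))⁻¹ * kummerM (-α / 2) (1 / 2) (z ^ 2 / 2)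
      - √(2 * Real.pi) * z * (Real.Gamma (-α / 2))⁻¹ *
          kummerM (1 / 2 - α / 2) (3 / 2) (z ^ 2 / 2))

/-- Away from the negative integers, `parabolicCylinderD` is given by the usual formula with
`cos`, `sin` and `Γ`. -/
theorem parabolicCylinderD_eq_cos_sin (α z : ℝ) (hα : ∀ n : ℕ, α ≠ -((n : ℝ) + 1)) :
    parabolicCylinderD α z =
      1 / √Real.pi * (2 : ℝ) ^ (α / 2) * Real.exp (-z ^ 2 / 4) *
        (Real.cos (Real.pi * α / 2) * Real.Gamma ((α + 1) / 2) *
            kummerM (-α / 2) (1 / 2) (z ^ 2 / 2)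
          + √2 * z * Real.sin (Real.pi * α / 2) * Real.Gamma (α / 2 + 1) *
            kummerM (1 / 2 - α / 2) (3 / 2) (z ^ 2 / 2)) := by
  have key : ∀ s : ℝ, Real.Gamma (1 - s) ≠ 0 →
      (Real.Gamma s)⁻¹ = Real.sin (Real.pi * s) * Real.Gamma (1 - s) / Real.pi := by
    intro s hs
    have h := Real.Gamma_mul_Gamma_one_sub s
    by_cases h0 : Real.sin (Real.pi * s) = 0
    · rw [h0, div_zero] at h
      have : Real.Gamma s = 0 := (mul_eq_zero.mp h).resolve_right hs
      simp [this, h0]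
    · have hpi := Real.pi_ne_zero
      have hg : Real.Gamma s ≠ 0 := by
        intro hg
        rw [hg, zero_mul] at h
        exact (div_ne_zero hpi h0) h.symm
      rw [eq_div_iff h0] at h
      rw [inv_eq_one_div, div_eq_div_iff hg hpi]
      linarith
  have e1 : (Real.Gamma ((1 - α) / 2))⁻¹ =
      Real.cos (Real.pi * α / 2) * Real.Gamma ((α + 1) / 2) / Real.pi := by
    have h1 : 1 - (1 - α) / 2 = (α + 1) / 2 := by ring
    rw [key, h1, show Real.pi * ((1 - α) / 2) = Real.pi / 2 - Real.pi * α / 2 by ring,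
      Real.sin_pi_div_two_sub]
    rw [h1]
    refine Real.Gamma_ne_zero fun m hm => hα (2 * m) ?_
    push_cast
    linarith
  have e2 : (Real.Gamma (-α / 2))⁻¹ =
      -(Real.sin (Real.pi * α / 2) * Real.Gamma (α / 2 + 1) / Real.pi) := by
    have h1 : 1 - (-α / 2) = α / 2 + 1 := by ring
    rw [key, h1, show Real.pi * (-α / 2) = -(Real.pi * α / 2) by ring, Real.sin_neg]
    · ring
    rw [h1]
    refine Real.Gamma_ne_zero fun m hm => hα (2 * m + 1) ?_
    push_cast
    linarith
  have hpi : √Real.pi ≠ 0 := (Real.sqrt_pos.mpr Real.pi_pos).ne'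
  have hsq : Real.pi = √Real.pi * √Real.pi := (Real.mul_self_sqrt Real.pi_pos.le).symm
  have hsplit : √(2 * Real.pi) = √2 * √Real.pi := Real.sqrt_mul (by norm_num) _
  have e3 : √Real.pi * Real.pi⁻¹ = 1 / √Real.pi := by
    nth_rewrite 2 [hsq]
    field_simp
  unfold parabolicCylinderD
  rw [e1, e2, hsplit, ← e3]
  ring

/-- The power-normalised parabolic cylinder function
`ℋ_α(x, t) = t^{α/2} e^{x²/(4t)} D_α(x/√t)`, for `t > 0`. -/
def powerParabolicCylinder (α x t : ℝ) : ℝ :=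
  t ^ (α / 2) * Real.exp (x ^ 2 / (4 * t)) * parabolicCylinderD α (x / √t)

/-! ### Distributions on the real line -/

/-- The space `𝓓'(ℝ)` of complex-valued distributions on `ℝ`. -/
abbrev DistR : Type := 𝓓'((⊤ : Opens ℝ), ℂ)

open Classical in
/-- Multiplication of test functions by a smooth function `f` (zero if `f` is not smooth). -/
def testMul (f : ℝ → ℝ) : 𝓓((⊤ : Opens ℝ), ℝ) →L[ℝ] 𝓓((⊤ : Opens ℝ), ℝ) :=
  if hf : ContDiff ℝ ∞ f then
    TestFunction.limitCLM ℝ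
      (fun φ => ⟨fun u => φ u * f u, φ.contDiff.mul hf, φ.hasCompactSupport.mul_right,
        fun _ _ => trivial⟩)
      (fun _ hK => TestFunction.ofSupportedInCLM ℝ hK ∘L
        ContDiffMapSupportedIn.bilinLeftCLM (ContinuousLinearMap.mul ℝ ℝ) hf)
      (fun _ _ _ => by ext; rfl)
  else 0

/-- The product `f g` of a distribution `g` with a smooth function `f`,
`⟨f g, φ⟩ = ⟨g, f φ⟩`. -/
def distMul (f : ℝ → ℝ) (g : DistR) : DistR :=
  (testMul f).precompCompactConvergenceCLM ℂ g

theorem testMul_apply {f : ℝ → ℝ} (hf : ContDiff ℝ ∞ f) (φ : 𝓓((⊤ : Opens ℝ), ℝ)) (u : ℝ) :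
    testMul f φ u = f u * φ u := by
  rw [testMul, dif_pos hf]
  exact mul_comm _ _

theorem distMul_apply (f : ℝ → ℝ) (g : DistR) (φ : 𝓓((⊤ : Opens ℝ), ℝ)) :
    distMul f g φ = g (testMul f φ) := rfl

/-- A test function, regarded as a (complex-valued) Schwartz function. -/
def testToSchwartz (φ : 𝓓((⊤ : Opens ℝ), ℝ)) : 𝓢(ℝ, ℂ) :=
  HasCompactSupport.toSchwartzMap (f := fun u => (φ u : ℂ))
    (φ.hasCompactSupport.comp_left (g := fun r : ℝ => (r : ℂ)) Complex.ofReal_zero)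
    (Complex.ofRealCLM.contDiff.comp φ.contDiff)

/-- The tempered distribution `T` restricts to `g` on test functions. -/
def Extends (T : 𝓢'(ℝ, ℂ)) (g : DistR) : Prop :=
  ∀ φ : 𝓓((⊤ : Opens ℝ), ℝ), T (testToSchwartz φ) = g φ

/-- `𝓓'⁺`: the distributions that vanish on `u < 0`. -/
def DPlus : Set DistR :=
  {g | ∀ φ : 𝓓((⊤ : Opens ℝ), ℝ), tsupport φ ⊆ Set.Iio 0 → g φ = 0}

/-- `𝓢'⁺ = 𝓓'⁺ ∩ 𝓢'`. -/
def SPlus : Set DistR :=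
  {g | g ∈ DPlus ∧ ∃ T : 𝓢'(ℝ, ℂ), Extends T g}

/-- `𝓓'⁺_a`: the distributions `g ∈ 𝓓'⁺` with `e^{-ξu} g(u) ∈ 𝓢'⁺` for all `ξ > a`. -/
def DPlusExp (a : ℝ) : Set DistR :=
  {g | g ∈ DPlus ∧ ∀ ξ : ℝ, a < ξ → distMul (fun u => Real.exp (-ξ * u)) g ∈ SPlus}

/-! ### Pairings, Laplace transform and Appell transform -/

/-- A smooth cutoff `λ` with `λ(u) = 1` in a neighbourhood of `[0, ∞)` and `λ(u) = 0` for
`u < -1`. -/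
def cutoff (u : ℝ) : ℝ := Real.smoothTransition (2 * (u + 1))

theorem cutoff_contDiff : ContDiff ℝ ∞ cutoff := by
  unfold cutoff
  exact Real.smoothTransition.contDiff.comp (by fun_prop)

theorem cutoff_eq_one {u : ℝ} (hu : -(1 / 2) ≤ u) : cutoff u = 1 :=
  Real.smoothTransition.one_of_one_le (by linarith)

theorem cutoff_eq_zero {u : ℝ} (hu : u ≤ -1) : cutoff u = 0 :=
  Real.smoothTransition.zero_of_nonpos (by linarith)

/-- `HasPairing g f v` says that `⟨g(u), f(u)⟩` is defined and equal to `v`, for a distribution `g`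
supported in `[0, ∞)`: `g` belongs to `𝓢'⁺`, the function `λ f` is a Schwartz function, and
`⟨g, λ f⟩ = v`. -/
def HasPairing (g : DistR) (f : ℝ → ℂ) (v : ℂ) : Prop :=
  g ∈ SPlus ∧ (∃ ψ : 𝓢(ℝ, ℂ), ∀ u, ψ u = cutoff u * f u) ∧
    ∀ (T : 𝓢'(ℝ, ℂ)) (ψ : 𝓢(ℝ, ℂ)),
      Extends T g → (∀ u, ψ u = cutoff u * f u) → T ψ = v

/-- `HasLaplace a g s v` says that the Laplace transform `⟨g(u), e^{-su}⟩` of `g ∈ 𝓓'⁺_a` at a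
point `s` with `Re s > a` is `v`, where `⟨g(u), e^{-su}⟩` is
`⟨e^{-ξu} g(u), λ(u) e^{-(s-ξ)u}⟩` for `a < ξ < Re s`. -/
def HasLaplace (a : ℝ) (g : DistR) (s v : ℂ) : Prop :=
  g ∈ DPlusExp a ∧ a < s.re ∧ ∀ ξ : ℝ, a < ξ → ξ < s.re →
    HasPairing (distMul (fun u => Real.exp (-ξ * u)) g)
      (fun u => Complex.exp (-(s - ξ) * u)) v

/-- `g = ℒ⁻¹{G}`: the distribution `g ∈ 𝓓'⁺_a` has Laplace transform `G` on `Re s > a`. -/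
def IsInverseLaplace (a : ℝ) (G : ℂ → ℂ) (g : DistR) : Prop :=
  g ∈ DPlusExp a ∧ ∀ s : ℂ, a < s.re → HasLaplace a g s (G s)

/-- `HasAppell a X P g y v` says that the Appell integral transform of `G = ℒ{g}` with respect to
the random variable `X`, i.e. `𝒜_X{G}(y) = ⟨g(u) / E e^{-uX}, e^{-uy}⟩`, is defined at `y` through
`g(u) / E e^{-uX} ∈ 𝓓'⁺_a` and has the value `v`. -/
def HasAppell {Ω : Type*} [MeasurableSpace Ω] (a : ℝ) (X : Ω → ℝ) (P : Measure Ω)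
    (g : DistR) (y v : ℂ) : Prop :=
  (∀ u : ℝ, Integrable (fun w => Real.exp (-u * X w)) P) ∧
  ContDiff ℝ ∞ (fun u : ℝ => (∫ w, Real.exp (-u * X w) ∂P)⁻¹) ∧
  HasLaplace a (distMul (fun u : ℝ => (∫ w, Real.exp (-u * X w) ∂P)⁻¹) g) y v

end

/-! ### Schwartz functions and tempered distributions on the line -/

/-! Choose a natural number `n > α` and put `β = n - α > 0`. The density `u^{β-1}/Γ(β)` on `(0, ∞)`
has Laplace transform `s^{-β}`, and each distributional derivative multiplies the transform by `s`.
So its `n`-th derivative `g_α` has transform `s^α` (`isInverseLaplace_rieszDist`).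

Uniqueness (`IsInverseLaplace.unique`): under `x = e^{-u}` the exponentials `e^{-(k+1)u}` become
monomials. A tempered distribution is bounded by finitely many seminorms, so Weierstrass
approximation with derivatives on `[0, e]` shows that it is determined by its values on these
exponentials, as far as cut-off test functions are concerned.

Since `E e^{-uW_t} = e^{tu²/2}`, the Appell transform at `x` is the pairing of `g_α` with `f(u) =
e^{-ux-u²t/2}`. Moving smooth factors across the pairing is legitimate because tempered extensions
are unique and supports lie in `[0, ∞)` (`hasPairing_distMul`).

The value of the pairing is found by induction on `n`, for all `β` at once
(`rieszDist_cutoff_mul_gaussian`). For `n = 0`, expanding `e^{-xu}` under the integral gives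
Gaussian moments, whose even and odd parts sum to the two Kummer series of `D_{-β}`
(`hasSum_rieszGaussianMoment`). For the step, `f' = -(x + tu) f` and `u g_α = -α g_{α-1}` give
`⟨g_{α+1}, f⟩ = x⟨g_α, f⟩ - tα⟨g_{α-1}, f⟩`. This is the recurrence
`powerParabolicCylinder_add_one`, a consequence of contiguous relations for Kummer's function. -/

theorem Function.HasTemperateGrowth.deriv {f : ℝ → ℂ} (hf : f.HasTemperateGrowth) :
    (deriv f).HasTemperateGrowth := by
  refine ⟨(contDiff_infty_iff_deriv.1 hf.1).2, fun n => ?_⟩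
  obtain ⟨k, C, h⟩ := hf.2 (n + 1)
  refine ⟨k, C, fun x => ?_⟩
  rw [norm_iteratedFDeriv_eq_norm_iteratedDeriv, ← iteratedDeriv_succ',
    ← norm_iteratedFDeriv_eq_norm_iteratedDeriv]
  exact h x

theorem Function.HasTemperateGrowth.exists_bound {f : ℝ → ℂ} (hf : f.HasTemperateGrowth) :
    ∃ (k : ℕ) (C : ℝ), 0 ≤ C ∧ ∀ u, ‖f u‖ ≤ C * (1 + |u|) ^ k := by
  obtain ⟨k, C, h⟩ := hf.2 0
  refine ⟨k, C, ?_, fun u => by simpa using h u⟩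
  simpa using (norm_nonneg _).trans (h 0)

theorem Function.HasTemperateGrowth.comp_div {f : ℝ → ℂ} (hf : f.HasTemperateGrowth) (c : ℝ) :
    (fun u => f (u / c)).HasTemperateGrowth := by
  have h : (fun u : ℝ => u / c).HasTemperateGrowth := by
    have := (c⁻¹ • ContinuousLinearMap.id ℝ ℝ).hasTemperateGrowth
    convert! this using 2 with u
    simp [div_eq_inv_mul]
  exact hf.comp h

theorem deriv_eq_zero_of_forall_mem {f : ℝ → ℂ} {s : Set ℝ} (hs : IsOpen s)
    (h : ∀ u ∈ s, f u = 0) : ∀ u ∈ s, deriv f u = 0 := by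
  intro u hu
  have : f =ᶠ[nhds u] fun _ => 0 := Filter.eventually_of_mem (hs.mem_nhds hu) h
  rw [this.deriv_eq, deriv_const]

theorem SchwartzMap.exists_one_add_pow_bound (ψ : 𝓢(ℝ, ℂ)) (m : ℕ) :
    ∃ C, ∀ u, (1 + |u|) ^ m * ‖ψ u‖ ≤ C :=
  ⟨_, fun u => by
    simpa using SchwartzMap.one_add_le_sup_seminorm_apply (𝕜 := ℝ) (m := (m, 0)) le_rfl le_rfl ψ u⟩

/-- A tempered distribution is controlled by finitely many Schwartz seminorms. -/
theorem exists_order_bound (T : 𝓢'(ℝ, ℂ)) :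
    ∃ (N : ℕ) (C : ℝ), 0 ≤ C ∧ ∀ (ψ : 𝓢(ℝ, ℂ)) (ε : ℝ), 0 ≤ ε →
      (∀ k ≤ N, ∀ i ≤ N, ∀ u, |u| ^ k * ‖iteratedDeriv i ψ u‖ ≤ ε) → ‖T ψ‖ ≤ C * ε := by
  let q : Seminorm ℂ 𝓢(ℝ, ℂ) := (normSeminorm ℂ ℂ).comp T.toLinearMap
  have hq : Continuous q := continuous_norm.comp T.continuous
  obtain ⟨s, C, -, h⟩ := Seminorm.bound_of_continuous (schwartz_withSeminorms ℂ ℝ ℂ) q hq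
  refine ⟨s.sup fun p => max p.1 p.2, C, C.2, fun ψ ε hε hψ => ?_⟩
  refine (h ψ).trans ?_
  change (C : ℝ) * _ ≤ _
  refine mul_le_mul_of_nonneg_left ?_ C.2
  refine Seminorm.finset_sup_apply_le hε fun p hp => ?_
  have hN : max p.1 p.2 ≤ s.sup fun p => max p.1 p.2 := Finset.le_sup (f := fun p => max p.1 p.2) hp
  exact SchwartzMap.seminorm_le_bound' ℂ p.1 p.2 ψ hε
    (hψ p.1 ((le_max_left _ _).trans hN) p.2 ((le_max_right _ _).trans hN))

/-- Where `η(u/n)` does not vanish one has `|u| ≥ n`, so one spare power of `|u|` pays for the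
factor `1/n`. A derivative falls either on `η(u/n)`, with a harmless coefficient `1/n ≤ 1`, or on
`ψ`; hence the induction runs over all `η` and `ψ`. -/
theorem exists_bound_iteratedDeriv_comp_div_mul (i : ℕ) :
    ∀ (η : ℝ → ℂ), η.HasTemperateGrowth → (∀ u ∈ Set.Ioo (-1 : ℝ) 1, η u = 0) →
      ∀ (ψ : 𝓢(ℝ, ℂ)) (k : ℕ), ∃ C, ∀ n : ℕ, 1 ≤ n → ∀ u,
        |u| ^ k * ‖iteratedDeriv i (fun u => η (u / n) * ψ u) u‖ ≤ C / n := by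
  induction i with
  | zero =>
    intro η hη h0 ψ k
    obtain ⟨j, C₀, hC₀, hb⟩ := hη.exists_bound
    obtain ⟨C₁, hC₁⟩ := ψ.exists_one_add_pow_bound (k + 1 + j)
    have hC₁0 : 0 ≤ C₁ := le_trans (by positivity) (hC₁ 0)
    refine ⟨C₀ * C₁, fun n hn u => ?_⟩
    have hn' : (1 : ℝ) ≤ n := by exact_mod_cast hn
    have hn0 : (0 : ℝ) < n := by linarith
    rw [iteratedDeriv_zero, norm_mul]
    by_cases hu : |u| < n
    · rw [h0 (u / n) (by rw [Set.mem_Ioo, ← abs_lt, abs_div, Nat.abs_cast, div_lt_one hn0]; exact hu)]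
      simp only [norm_zero, zero_mul, mul_zero]
      positivity
    · rw [not_lt] at hu
      rw [le_div_iff₀ hn0]
      have h1 : ‖η (u / n)‖ ≤ C₀ * (1 + |u|) ^ j := by
        refine (hb _).trans ?_
        have : |u / n| ≤ |u| := by
          rw [abs_div, Nat.abs_cast]
          exact div_le_self (abs_nonneg _) hn'
        gcongr
      calc |u| ^ k * (‖η (u / n)‖ * ‖ψ u‖) * n
          ≤ (1 + |u|) ^ k * ((C₀ * (1 + |u|) ^ j) * ‖ψ u‖) * (1 + |u|) := by
            gcongr <;> linarith [abs_nonneg u]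
        _ = C₀ * ((1 + |u|) ^ (k + 1 + j) * ‖ψ u‖) := by ring
        _ ≤ C₀ * C₁ := by gcongr; exact hC₁ u
  | succ i ih =>
    intro η hη h0 ψ k
    obtain ⟨C₁, h₁⟩ := ih (deriv η) hη.deriv (deriv_eq_zero_of_forall_mem isOpen_Ioo h0) ψ k
    obtain ⟨C₂, h₂⟩ := ih η hη h0 (SchwartzMap.derivCLM ℂ ℂ ψ) k
    refine ⟨C₁ + C₂, fun n hn u => ?_⟩
    have hn' : (1 : ℝ) ≤ n := by exact_mod_cast hn
    have hd : deriv (fun u : ℝ => η (u / n) * ψ u) =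
        fun u => ((n : ℂ)⁻¹) * (deriv η (u / n) * ψ u) +
          η (u / n) * (SchwartzMap.derivCLM ℂ ℂ ψ) u := by
      ext u
      have e1 : HasDerivAt (fun u : ℝ => η (u / n)) ((n : ℝ)⁻¹ • deriv η (u / n)) u := by
        have := ((hη.1.differentiable (by simp)) (u / n)).hasDerivAt.scomp u
          ((hasDerivAt_id u).div_const (n : ℝ))
        simpa [Function.comp_def] using this
      rw [(e1.fun_mul (ψ.hasDerivAt u)).deriv, SchwartzMap.derivCLM_apply, Complex.real_smul]
      push_cast
      ring
    have c1 : ContDiff ℝ ∞ (fun u : ℝ => deriv η (u / n) * ψ u) :=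
      (hη.deriv.comp_div n).1.mul (ψ.smooth ⊤)
    have c2 : ContDiff ℝ ∞ (fun u : ℝ => η (u / n) * (SchwartzMap.derivCLM ℂ ℂ ψ) u) :=
      (hη.comp_div n).1.mul ((SchwartzMap.derivCLM ℂ ℂ ψ).smooth ⊤)
    have hi : (i : WithTop ℕ∞) ≤ ∞ := mod_cast le_top
    rw [iteratedDeriv_succ', hd, iteratedDeriv_fun_add (contDiff_const.mul (c1.of_le hi)).contDiffAt
      (c2.of_le hi).contDiffAt, iteratedDeriv_const_mul_field]
    calc _ ≤ |u| ^ k * (‖(n : ℂ)⁻¹‖ * ‖iteratedDeriv i (fun u : ℝ => deriv η (u / n) * ψ u) u‖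
          + ‖iteratedDeriv i (fun u : ℝ => η (u / n) * (SchwartzMap.derivCLM ℂ ℂ ψ) u) u‖) := by
          gcongr
          exact (norm_add_le _ _).trans (by rw [norm_mul])
      _ ≤ |u| ^ k * (1 * ‖iteratedDeriv i (fun u : ℝ => deriv η (u / n) * ψ u) u‖
          + ‖iteratedDeriv i (fun u : ℝ => η (u / n) * (SchwartzMap.derivCLM ℂ ℂ ψ) u) u‖) := by
          gcongr
          rw [norm_inv, Complex.norm_natCast]
          exact inv_le_one_of_one_le₀ hn'
      _ ≤ C₁ / n + C₂ / n := by
          rw [one_mul, mul_add]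
          exact add_le_add (h₁ n hn u) (h₂ n hn u)
      _ = (C₁ + C₂) / n := by ring

/-- A tempered distribution vanishes on `ψ` if it vanishes on all compactly supported Schwartz
functions that vanish wherever `ψ` does. -/
theorem tempered_apply_eq_zero_of_compactSupport (T : 𝓢'(ℝ, ℂ)) (ψ : 𝓢(ℝ, ℂ))
    (h : ∀ φ : 𝓢(ℝ, ℂ), HasCompactSupport φ → (∀ u, ψ u = 0 → φ u = 0) → T φ = 0) :
    T ψ = 0 := by
  let b : ContDiffBump (0 : ℝ) := ⟨1, 2, one_pos, one_lt_two⟩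
  let χ : ℝ → ℂ := fun u => (b u : ℂ)
  have hχs : ContDiff ℝ ∞ χ := Complex.ofRealCLM.contDiff.comp b.contDiff
  have hχc : HasCompactSupport χ := b.hasCompactSupport.comp_left Complex.ofReal_zero
  have hχ : χ.HasTemperateGrowth := hχc.hasTemperateGrowth hχs
  let η : ℝ → ℂ := fun u => 1 - χ u
  have hη : η.HasTemperateGrowth := (Function.HasTemperateGrowth.const 1).sub hχ
  have hη0 : ∀ u ∈ Set.Ioo (-1 : ℝ) 1, η u = 0 := fun u hu => by
    have : b u = 1 := b.one_of_mem_closedBall (by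
      rw [mem_closedBall_zero_iff, Real.norm_eq_abs]; exact (abs_lt.2 hu).le)
    simp [η, χ, this]
  obtain ⟨N, C, hC, hT⟩ := exists_order_bound T
  choose! B hB using fun i k => exists_bound_iteratedDeriv_comp_div_mul i η hη hη0 ψ k
  let M : ℝ := ∑ i ∈ Finset.range (N + 1), ∑ k ∈ Finset.range (N + 1), |B i k|
  have hM : ∀ k ≤ N, ∀ i ≤ N, B i k ≤ M := fun k hk i hi => by
    refine (le_abs_self _).trans ?_
    refine le_trans ?_ (Finset.single_le_sum (f := fun i => ∑ k ∈ Finset.range (N + 1), |B i k|)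
      (fun i _ => Finset.sum_nonneg fun k _ => abs_nonneg _) (Finset.mem_range_succ_iff.2 hi))
    exact Finset.single_le_sum (f := fun k => |B i k|) (fun k _ => abs_nonneg _)
      (Finset.mem_range_succ_iff.2 hk)
  have hM0 : 0 ≤ M := Finset.sum_nonneg fun i _ => Finset.sum_nonneg fun k _ => abs_nonneg _
  -- The truncation `χ(u/n) ψ` is compactly supported and vanishes wherever `ψ` does, so `T` kills
  -- it. What remains is `T (η(u/n) ψ)`, which is `O(1/n)`.
  have key : ∀ n : ℕ, 1 ≤ n → ‖T ψ‖ ≤ C * (M / n) := by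
    intro n hn
    have hn0 : (0 : ℝ) < n := by exact_mod_cast hn
    let φ : 𝓢(ℝ, ℂ) := SchwartzMap.smulLeftCLM ℂ (fun u => χ (u / n)) ψ
    have hφ : ∀ u, φ u = χ (u / n) * ψ u := fun u => by
      simp only [φ, SchwartzMap.smulLeftCLM_apply_apply (hχ.comp_div n), smul_eq_mul]
    have hφ0 : T φ = 0 := by
      refine h φ ?_ fun u hu => by rw [hφ, hu, mul_zero]
      have e : (φ : ℝ → ℂ) = fun u => χ (u / n) * ψ u := funext hφ
      rw [e]
      refine HasCompactSupport.mul_right ?_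
      have := hχc.comp_homeomorph (Homeomorph.mulRight₀ ((n : ℝ)⁻¹) (by positivity))
      simpa [Function.comp_def, div_eq_mul_inv] using this
    have e : T ψ = T (ψ - φ) := by rw [map_sub, hφ0, sub_zero]
    rw [e]
    refine hT _ _ (by positivity) fun k hk i hi u => ?_
    have e2 : ((ψ - φ : 𝓢(ℝ, ℂ)) : ℝ → ℂ) = fun u => η (u / n) * ψ u := by
      ext u
      rw [sub_apply, hφ]
      simp only [η]
      ring
    rw [e2]
    refine (hB i k n hn u).trans ?_
    gcongr
    exact hM k hk i hi
  have hlim : Filter.Tendsto (fun n : ℕ => C * (M / n)) Filter.atTop (nhds 0) := by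
    simpa using (tendsto_const_div_atTop_nhds_zero_nat M).const_mul C
  have : ‖T ψ‖ ≤ 0 := ge_of_tendsto hlim (Filter.eventually_atTop.2 ⟨1, key⟩)
  exact norm_le_zero_iff.1 this

theorem testToSchwartz_apply (φ : 𝓓((⊤ : Opens ℝ), ℝ)) (u : ℝ) :
    testToSchwartz φ u = (φ u : ℂ) := rfl

/-- A compactly supported Schwartz function splits into its real and imaginary parts. -/
theorem exists_testToSchwartz_add (φ : 𝓢(ℝ, ℂ)) (hφ : HasCompactSupport φ) :
    ∃ φ₁ φ₂ : 𝓓((⊤ : Opens ℝ), ℝ), φ = testToSchwartz φ₁ + Complex.I • testToSchwartz φ₂ ∧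
      (∀ u, φ₁ u = (φ u).re) ∧ ∀ u, φ₂ u = (φ u).im := by
  refine ⟨⟨fun u => (φ u).re, Complex.reCLM.contDiff.comp (φ.smooth ⊤),
    hφ.comp_left (g := Complex.re) rfl, fun _ _ => trivial⟩,
    ⟨fun u => (φ u).im, Complex.imCLM.contDiff.comp (φ.smooth ⊤),
    hφ.comp_left (g := Complex.im) rfl, fun _ _ => trivial⟩, ?_, fun _ => rfl, fun _ => rfl⟩
  ext u
  rw [add_apply, smul_apply, testToSchwartz_apply, testToSchwartz_apply,
    smul_eq_mul, mul_comm]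
  exact (Complex.re_add_im (φ u)).symm

/-- The tempered extension of a distribution is unique. -/
theorem Extends.unique {T₁ T₂ : 𝓢'(ℝ, ℂ)} {g : DistR} (h₁ : Extends T₁ g) (h₂ : Extends T₂ g) :
    T₁ = T₂ := by
  ext ψ
  rw [← sub_eq_zero]
  change (T₁ - T₂) ψ = 0
  refine tempered_apply_eq_zero_of_compactSupport _ ψ fun φ hφ _ => ?_
  obtain ⟨φ₁, φ₂, h, -, -⟩ := exists_testToSchwartz_add φ hφ
  change T₁ φ - T₂ φ = 0
  rw [h]
  simp only [map_add, map_smul, h₁ _, h₂ _, sub_self]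

/-- A tempered extension of a distribution supported in `[0, ∞)` only depends on the values of
test functions on `(-1/2, ∞)`. -/
theorem Extends.apply_congr {T : 𝓢'(ℝ, ℂ)} {g : DistR} (hT : Extends T g) (hg : g ∈ DPlus)
    {ψ₁ ψ₂ : 𝓢(ℝ, ℂ)} (h : ∀ u, -(1 / 2) < u → ψ₁ u = ψ₂ u) : T ψ₁ = T ψ₂ := by
  rw [← sub_eq_zero, ← map_sub]
  refine tempered_apply_eq_zero_of_compactSupport _ _ fun φ hφ h0 => ?_
  obtain ⟨φ₁, φ₂, e, h₁, h₂⟩ := exists_testToSchwartz_add φ hφ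
  have hz : ∀ u, -(1 / 2) < u → φ u = 0 := fun u hu => h0 u (by
    rw [sub_apply, h u hu, sub_self])
  have hs : ∀ φ' : 𝓓((⊤ : Opens ℝ), ℝ), (∀ u, -(1 / 2) < u → φ' u = 0) → g φ' = 0 := by
    intro φ' h'
    refine hg φ' ?_
    -- The margin between `-1/2` and `0` matters: the closed support has to lie in the open
    -- half-line `(-∞, 0)`.
    have : tsupport φ' ⊆ Set.Iic (-(1 / 2)) := closure_minimal (fun u hu => by
      by_contra hc
      exact hu (h' u (not_le.1 hc))) isClosed_Iic
    exact this.trans (Set.Iic_subset_Iio.2 (by norm_num))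
  rw [e]
  simp only [map_add, map_smul, hT _]
  rw [hs φ₁ fun u hu => by rw [h₁, hz u hu, Complex.zero_re],
    hs φ₂ fun u hu => by rw [h₂, hz u hu, Complex.zero_im], smul_zero, add_zero]

/-! ### Restriction of tempered distributions to test functions -/

theorem testToSchwartz_add (φ₁ φ₂ : 𝓓((⊤ : Opens ℝ), ℝ)) :
    testToSchwartz (φ₁ + φ₂) = testToSchwartz φ₁ + testToSchwartz φ₂ := by
  ext u
  exact Complex.ofReal_add _ _

theorem testToSchwartz_smul (c : ℝ) (φ : 𝓓((⊤ : Opens ℝ), ℝ)) :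
    testToSchwartz (c • φ) = (c : ℂ) • testToSchwartz φ := by
  ext u
  exact Complex.ofReal_mul _ _

/-- On a fixed compact set the weights `|u|^k` are bounded, so the finitely many Schwartz seminorms
controlling `T` are dominated by suprema of derivatives. -/
theorem continuous_tempered_comp_testToSchwartz (T : 𝓢'(ℝ, ℂ)) (K : Compacts ℝ)
    (hK : (K : Set ℝ) ⊆ (⊤ : Opens ℝ)) :
    Continuous ((fun φ => T (testToSchwartz φ)) ∘ TestFunction.ofSupportedIn (F := ℝ) (n := ⊤) hK) := by
  obtain ⟨N, C, hC, hT⟩ := exists_order_bound T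
  obtain ⟨R, hR⟩ := K.isCompact.isBounded.exists_norm_le
  -- The maximum with `1` gives `R'^k ≤ R'^N` for every `k ≤ N`.
  let R' := max R 1
  have hR1 : (1 : ℝ) ≤ R' := le_max_right _ _
  refine (ContDiffMapSupportedIn.mkCLMtoNormedSpace (𝕜 := ℝ)
    ((fun φ => T (testToSchwartz φ)) ∘ TestFunction.ofSupportedIn (F := ℝ) (n := ⊤) hK)
    (fun φ₁ φ₂ => ?_) (fun c φ => ?_)
    ⟨Finset.range (N + 1), C * R' ^ N, by positivity, fun φ => ?_⟩).continuous
  · change T (testToSchwartz (TestFunction.ofSupportedIn hK φ₁ + TestFunction.ofSupportedIn hK φ₂)) = _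
    rw [testToSchwartz_add, map_add]
    rfl
  · change T (testToSchwartz (c • TestFunction.ofSupportedIn hK φ)) = _
    rw [testToSchwartz_smul, map_smul, smul_eq_mul, Complex.real_smul]
    rfl
  · set S := ((Finset.range (N + 1)).sup fun i => N[ℝ]_{K, ⊤, i}) φ with hS
    rw [mul_assoc]
    refine hT _ _ (by positivity) fun k hk i hi u => ?_
    have e : ‖iteratedDeriv i (testToSchwartz (TestFunction.ofSupportedIn hK φ)) u‖ =
        ‖iteratedFDeriv ℝ i φ u‖ := by
      rw [← norm_iteratedFDeriv_eq_norm_iteratedDeriv]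
      exact Complex.ofRealLI.norm_iteratedFDeriv_comp_left (f := φ)
        (φ.contDiff.contDiffAt (x := u)) (mod_cast le_top)
    rw [e]
    have h1 : ‖iteratedFDeriv ℝ i φ u‖ ≤ S :=
      (ContDiffMapSupportedIn.norm_iteratedFDeriv_apply_le_seminorm_top ℝ).trans
        (Seminorm.le_def.1 (Finset.le_sup (f := fun i => N[ℝ]_{K, ⊤, i})
          (Finset.mem_range_succ_iff.2 hi)) φ)
    by_cases hu : u ∈ K
    · refine mul_le_mul ?_ h1 (norm_nonneg _) (by positivity)
      calc |u| ^ k ≤ R' ^ k := by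
            gcongr
            exact (hR u hu).trans (le_max_left _ _)
        _ ≤ R' ^ N := pow_le_pow_right₀ hR1 hk
    · rw [φ.iteratedFDeriv_zero_on_compl hu]
      simp only [Pi.zero_apply, norm_zero, mul_zero]
      exact mul_nonneg (by positivity) ((norm_nonneg _).trans h1)

/-- The restriction of a tempered distribution to test functions. -/
noncomputable def restrictDist (T : 𝓢'(ℝ, ℂ)) : DistR :=
  TestFunction.mkCLM ℝ (fun φ => T (testToSchwartz φ))
    (fun φ₁ φ₂ => by rw [testToSchwartz_add, map_add])
    (fun c φ => by rw [testToSchwartz_smul, map_smul, smul_eq_mul, Complex.real_smul])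
    (continuous_tempered_comp_testToSchwartz T)

theorem extends_restrictDist (T : 𝓢'(ℝ, ℂ)) : Extends T (restrictDist T) := fun _ => rfl

/-! ### Cutoff functions times exponentials -/

theorem cutoff_nonneg (u : ℝ) : 0 ≤ cutoff u := Real.smoothTransition.nonneg _

theorem cutoff_le_one (u : ℝ) : cutoff u ≤ 1 := Real.smoothTransition.le_one _

/-- The cutoff is bounded, and its derivative is smooth with support in `[-1, 0]`. -/
theorem cutoff_hasTemperateGrowth : (fun u => (cutoff u : ℂ)).HasTemperateGrowth := by
  have hs : ContDiff ℝ ∞ (fun u => (cutoff u : ℂ)) :=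
    Complex.ofRealCLM.contDiff.comp cutoff_contDiff
  refine Function.HasTemperateGrowth.of_fderiv (k := 0) (C := 1) ?_ (hs.differentiable (by simp))
    fun u => ?_
  · refine HasCompactSupport.hasTemperateGrowth ?_ (hs.fderiv_right le_rfl)
    refine HasCompactSupport.intro (isCompact_Icc (a := (-1 : ℝ)) (b := 0)) fun u hu => ?_
    rw [Set.mem_Icc, not_and_or, not_le, not_le] at hu
    rcases hu with hu | hu
    · have : (fun u => (cutoff u : ℂ)) =ᶠ[nhds u] fun _ => 0 := by
        filter_upwards [Iio_mem_nhds hu] with v hv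
        rw [cutoff_eq_zero (le_of_lt hv), Complex.ofReal_zero]
      rw [this.fderiv_eq, fderiv_fun_const, Pi.zero_apply]
    · have : (fun u => (cutoff u : ℂ)) =ᶠ[nhds u] fun _ => 1 := by
        filter_upwards [Ioi_mem_nhds hu] with v hv
        rw [cutoff_eq_one (by linarith [Set.mem_Ioi.1 hv]), Complex.ofReal_one]
      rw [this.fderiv_eq, fderiv_fun_const, Pi.zero_apply]
  · rw [Complex.norm_real, Real.norm_eq_abs, abs_of_nonneg (cutoff_nonneg u), pow_zero, mul_one]
    exact cutoff_le_one u

/-- The class of functions `h e^p` is stable under differentiation, since `(h e^p)' = (h' + h p')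
e^p` and the new prefactor again has temperate growth and vanishes for `u < -1`. Decay of `e^p` is
thus needed only on `[-1, ∞)`. -/
theorem exists_bound_iteratedDeriv_mul_exp {p : ℝ → ℂ} (hp : p.HasTemperateGrowth)
    (hdecay : ∀ k : ℕ, ∃ C, ∀ u : ℝ, -1 ≤ u → (1 + |u|) ^ k * Real.exp (p u).re ≤ C) (i : ℕ) :
    ∀ h : ℝ → ℂ, h.HasTemperateGrowth → (∀ u ∈ Set.Iio (-1 : ℝ), h u = 0) → ∀ k : ℕ,
      ∃ C, ∀ u, |u| ^ k * ‖iteratedDeriv i (fun u => h u * Complex.exp (p u)) u‖ ≤ C := by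
  induction i with
  | zero =>
    intro h hh h0 k
    obtain ⟨j, C₀, hC₀, hb⟩ := hh.exists_bound
    obtain ⟨C₁, hC₁⟩ := hdecay (k + j)
    refine ⟨C₀ * C₁, fun u => ?_⟩
    rw [iteratedDeriv_zero, norm_mul, Complex.norm_exp]
    by_cases hu : u < -1
    · rw [h0 u hu, norm_zero, zero_mul, mul_zero]
      exact mul_nonneg hC₀ (le_trans (by positivity) (hC₁ 0 (by norm_num)))
    · calc |u| ^ k * (‖h u‖ * Real.exp (p u).re)
          ≤ (1 + |u|) ^ k * ((C₀ * (1 + |u|) ^ j) * Real.exp (p u).re) := by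
            gcongr
            · linarith
            · exact hb u
        _ = C₀ * ((1 + |u|) ^ (k + j) * Real.exp (p u).re) := by ring
        _ ≤ C₀ * C₁ := by gcongr; exact hC₁ u (not_lt.1 hu)
  | succ i ih =>
    intro h hh h0 k
    have h0' := deriv_eq_zero_of_forall_mem isOpen_Iio h0
    obtain ⟨C, hC⟩ := ih (deriv h + h * deriv p) (hh.deriv.add (hh.mul hp.deriv))
      (fun u hu => by simp [h0 u hu, h0' u hu]) k
    refine ⟨C, fun u => ?_⟩
    have hd : deriv (fun u => h u * Complex.exp (p u)) =
        fun u => (deriv h + h * deriv p) u * Complex.exp (p u) := by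
      ext u
      have e1 := (hh.1.differentiable (by simp) u).hasDerivAt
      have e2 := ((hp.1.differentiable (by simp) u).hasDerivAt).cexp
      rw [(e1.fun_mul e2).deriv, Pi.add_apply, Pi.mul_apply]
      ring
    rw [iteratedDeriv_succ', hd]
    exact hC u

theorem exists_one_add_abs_pow_mul_exp_bound {δ A : ℝ} (hδ : 0 < δ) (k : ℕ) :
    ∃ C, ∀ u : ℝ, -1 ≤ u → (1 + |u|) ^ k * Real.exp (A - δ * u) ≤ C := by
  refine ⟨k.factorial / δ ^ k * Real.exp (A + 3 * δ), fun u hu => ?_⟩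
  have h1 : 1 + |u| ≤ u + 3 := by
    have : |u| ≤ u + 2 := abs_le.2 ⟨by linarith, by linarith⟩
    linarith
  have h2 := Real.pow_div_factorial_le_exp (δ * (u + 3)) (by nlinarith) k
  have h3 : Real.exp (A - δ * u) = Real.exp (A + 3 * δ) * (Real.exp (δ * (u + 3)))⁻¹ := by
    rw [← Real.exp_neg, ← Real.exp_add]
    ring_nf
  have h4 : (u + 3) ^ k ≤ k.factorial / δ ^ k * Real.exp (δ * (u + 3)) := by
    rw [div_le_iff₀ (by positivity), mul_pow] at h2
    rw [div_mul_eq_mul_div, le_div_iff₀ (by positivity)]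
    linarith
  calc (1 + |u|) ^ k * Real.exp (A - δ * u) ≤ (u + 3) ^ k * Real.exp (A - δ * u) := by gcongr
    _ ≤ (k.factorial / δ ^ k * Real.exp (δ * (u + 3))) * Real.exp (A - δ * u) := by gcongr
    _ = _ := by
      rw [h3]
      field_simp

/-- The functions `λ(u) e^{-zu-cu²}` are Schwartz functions for `c > 0`, and for `c = 0` and
`Re z > 0`. -/
theorem exists_schwartz_cutoff_mul_exp (z : ℂ) (c : ℝ) (h : 0 < c ∨ c = 0 ∧ 0 < z.re) :
    ∃ ψ : 𝓢(ℝ, ℂ), ∀ u : ℝ, ψ u = cutoff u * Complex.exp (-z * u - c * u ^ 2) := by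
  let p : ℝ → ℂ := fun u => -z * u - c * u ^ 2
  have hp : p.HasTemperateGrowth := by
    have h1 : (fun u : ℝ => (u : ℂ)).HasTemperateGrowth := Complex.ofRealCLM.hasTemperateGrowth
    exact ((Function.HasTemperateGrowth.const (-z)).mul h1).sub
      ((Function.HasTemperateGrowth.const (c : ℂ)).mul (h1.pow 2))
  have hre : ∀ u : ℝ, (p u).re = -z.re * u - c * u ^ 2 := fun u => by
    simp [p, ← Complex.ofReal_pow]
  have hle : ∃ δ A : ℝ, 0 < δ ∧ ∀ u : ℝ, (p u).re ≤ A - δ * u := by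
    rcases h with hc | ⟨rfl, hz⟩
    -- The constant comes from completing the square in `c u² + (Re z - 1) u`.
    · refine ⟨1, (z.re - 1) ^ 2 / (4 * c), one_pos, fun u => ?_⟩
      rw [hre]
      have : (z.re - 1) ^ 2 / (4 * c) + c * u ^ 2 + (z.re - 1) * u =
          c * (u + (z.re - 1) / (2 * c)) ^ 2 := by
        field_simp
        ring
      nlinarith [mul_nonneg hc.le (sq_nonneg (u + (z.re - 1) / (2 * c)))]
    · exact ⟨z.re, 0, hz, fun u => by rw [hre]; linarith⟩
  obtain ⟨δ, A, hδ, hle⟩ := hle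
  have hdecay : ∀ k : ℕ, ∃ C, ∀ u : ℝ, -1 ≤ u → (1 + |u|) ^ k * Real.exp (p u).re ≤ C := by
    intro k
    obtain ⟨C, hC⟩ := exists_one_add_abs_pow_mul_exp_bound (A := A) hδ k
    exact ⟨C, fun u hu => (mul_le_mul_of_nonneg_left (Real.exp_le_exp.2 (hle u))
      (by positivity)).trans (hC u hu)⟩
  refine ⟨⟨fun u => cutoff u * Complex.exp (p u), ?_, fun k i => ?_⟩, fun u => rfl⟩
  · exact cutoff_hasTemperateGrowth.1.mul hp.1.cexp
  · obtain ⟨C, hC⟩ := exists_bound_iteratedDeriv_mul_exp hp hdecay i _ cutoff_hasTemperateGrowth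
      (fun u hu => by rw [cutoff_eq_zero (le_of_lt hu), Complex.ofReal_zero]) k
    refine ⟨C, fun u => ?_⟩
    rw [norm_iteratedFDeriv_eq_norm_iteratedDeriv]
    exact hC u

/-! ### Pairings with products -/

theorem testToSchwartz_testMul {m : ℝ → ℝ} (hm : ContDiff ℝ ∞ m) (φ : 𝓓((⊤ : Opens ℝ), ℝ)) (u : ℝ) :
    testToSchwartz (testMul m φ) u = m u * testToSchwartz φ u := by
  rw [testToSchwartz_apply, testMul_apply hm, Complex.ofReal_mul, testToSchwartz_apply]

theorem distMul_mem_DPlus {m : ℝ → ℝ} (hm : ContDiff ℝ ∞ m) {g : DistR} (hg : g ∈ DPlus) :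
    distMul m g ∈ DPlus := by
  intro φ hφ
  rw [distMul_apply]
  refine hg _ (subset_trans ?_ hφ)
  refine closure_mono fun u hu => ?_
  rw [Function.mem_support, testMul_apply hm] at hu
  exact right_ne_zero_of_mul hu

/-- The multiplier `m` may grow fast as `u → -∞`, as `e^{-ξu}` does. The support of `g` allows
replacing it by `λ m`, so only that product needs temperate growth. -/
theorem Extends.distMul {T : 𝓢'(ℝ, ℂ)} {g : DistR} (hT : Extends T g) (hg : g ∈ DPlus)
    {m : ℝ → ℝ} (hm : ContDiff ℝ ∞ m)
    (hm' : (fun u => (cutoff u : ℂ) * m u).HasTemperateGrowth) :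
    Extends (TemperedDistribution.smulLeftCLM ℂ (fun u => (cutoff u : ℂ) * m u) T)
      (distMul m g) := by
  intro φ
  rw [TemperedDistribution.smulLeftCLM_apply_apply, distMul_apply, ← hT]
  refine hT.apply_congr hg fun u hu => ?_
  rw [SchwartzMap.smulLeftCLM_apply_apply hm', testToSchwartz_testMul hm, cutoff_eq_one hu.le,
    Complex.ofReal_one, one_mul, smul_eq_mul]

theorem distMul_mem_SPlus {g : DistR} (hg : g ∈ SPlus) {m : ℝ → ℝ} (hm : ContDiff ℝ ∞ m)
    (hm' : (fun u => (cutoff u : ℂ) * m u).HasTemperateGrowth) : distMul m g ∈ SPlus :=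
  have ⟨hg', _, hT⟩ := hg
  ⟨distMul_mem_DPlus hm hg', _, hT.distMul hg' hm hm'⟩

/-- `⟨m g, f⟩ = ⟨g, m f⟩`. -/
theorem hasPairing_distMul {T : 𝓢'(ℝ, ℂ)} {g : DistR} (hT : Extends T g) (hg : g ∈ DPlus)
    {m : ℝ → ℝ} (hm : ContDiff ℝ ∞ m)
    (hm' : (fun u => (cutoff u : ℂ) * m u).HasTemperateGrowth) {f : ℝ → ℂ}
    (hf : ∃ ψ : 𝓢(ℝ, ℂ), ∀ u, ψ u = cutoff u * f u) {Φ : 𝓢(ℝ, ℂ)}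
    (hΦ : ∀ u, -(1 / 2) < u → Φ u = m u * f u) :
    HasPairing (distMul m g) f (T Φ) := by
  have hT' := hT.distMul hg hm hm'
  refine ⟨⟨distMul_mem_DPlus hm hg, _, hT'⟩, hf, fun T₁ ψ hT₁ hψ => ?_⟩
  rw [hT₁.unique hT', TemperedDistribution.smulLeftCLM_apply_apply]
  refine hT.apply_congr hg fun u hu => ?_
  rw [SchwartzMap.smulLeftCLM_apply_apply hm', hΦ u hu, hψ, cutoff_eq_one hu.le,
    Complex.ofReal_one, one_mul, one_mul, smul_eq_mul]

theorem hasPairing_of_extends {T : 𝓢'(ℝ, ℂ)} {g : DistR} (hT : Extends T g) (hg : g ∈ DPlus)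
    {f : ℝ → ℂ} {Φ : 𝓢(ℝ, ℂ)} (hΦ : ∀ u, Φ u = cutoff u * f u) :
    HasPairing g f (T Φ) := by
  refine ⟨⟨hg, T, hT⟩, ⟨Φ, hΦ⟩, fun T₁ ψ hT₁ hψ => ?_⟩
  rw [hT₁.unique hT]
  congr 1
  ext u
  rw [hψ, hΦ]

theorem distMul_distMul {m₁ m₂ : ℝ → ℝ} (h₁ : ContDiff ℝ ∞ m₁) (h₂ : ContDiff ℝ ∞ m₂)
    (g : DistR) : distMul m₁ (distMul m₂ g) = distMul (fun u => m₁ u * m₂ u) g := by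
  ext φ
  rw [distMul_apply, distMul_apply, distMul_apply]
  congr 1
  ext u
  rw [testMul_apply h₂, testMul_apply h₁, testMul_apply (h₁.mul h₂)]
  ring

/-! ### Injectivity of the Laplace transform -/

theorem Polynomial.exists_derivative_eq_eval_zero_eq (Q : Polynomial ℝ) (c : ℝ) :
    ∃ P : Polynomial ℝ, Polynomial.derivative P = Q ∧ P.eval 0 = c := by
  refine ⟨∑ k ∈ Finset.range (Q.natDegree + 1),
    Polynomial.monomial (k + 1) (Q.coeff k / (k + 1)) + Polynomial.C c, ?_, ?_⟩
  · rw [Polynomial.derivative_add, Polynomial.derivative_C, add_zero, Polynomial.derivative_sum]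
    conv_rhs => rw [Q.as_sum_range]
    refine Finset.sum_congr rfl fun k _ => ?_
    rw [Polynomial.derivative_monomial]
    have : (k : ℝ) + 1 ≠ 0 := by positivity
    simp [this]
  · simp [Polynomial.eval_finsetSum]

/-- Weierstrass approximation with derivatives. -/
theorem exists_polynomial_iteratedDeriv_near {b : ℝ} (hb : 0 < b) (N : ℕ) :
    ∀ F : ℝ → ℝ, ContDiff ℝ ∞ F → ∀ ε > 0, ∃ P : Polynomial ℝ, ∀ k ≤ N, ∀ x ∈ Set.Icc 0 b,
      |iteratedDeriv k (fun x => F x - P.eval x) x| ≤ ε := by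
  induction N with
  | zero =>
    intro F hF ε hε
    obtain ⟨P, hP⟩ := exists_polynomial_near_of_continuousOn 0 b F hF.continuous.continuousOn ε hε
    refine ⟨P, fun k hk x hx => ?_⟩
    obtain rfl : k = 0 := by omega
    rw [iteratedDeriv_zero, abs_sub_comm]
    exact (hP x hx).le
  | succ N ih =>
    intro F hF ε hε
    have hF' := (contDiff_infty_iff_deriv.1 hF)
    -- The bound `ε` serves the derivatives of order at least one; `ε / b` makes the mean value
    -- inequality on `[0, b]` give `ε` for order zero.
    obtain ⟨Q, hQ⟩ := ih (deriv F) hF'.2 (min ε (ε / b)) (by positivity)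
    obtain ⟨P, hPQ, hP0⟩ := Q.exists_derivative_eq_eval_zero_eq (F 0)
    have hd : ∀ x, HasDerivAt (fun x => F x - P.eval x) (deriv F x - Q.eval x) x := fun x => by
      rw [← hPQ]
      exact (hF'.1 x).hasDerivAt.fun_sub (P.hasDerivAt x)
    refine ⟨P, fun k hk x hx => ?_⟩
    rcases k with - | k
    · rw [iteratedDeriv_zero]
      have := norm_image_sub_le_of_norm_deriv_le_segment' (f := fun x => F x - P.eval x)
        (f' := fun x => deriv F x - Q.eval x) (C := ε / b) (a := 0) (b := b)
        (fun x _ => (hd x).hasDerivWithinAt)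
        (fun x hx => by
          have := hQ 0 (Nat.zero_le _) x ⟨hx.1, hx.2.le⟩
          rw [iteratedDeriv_zero] at this
          exact this.trans (min_le_right _ _)) x hx
      simp only [hP0, sub_self, sub_zero, Real.norm_eq_abs] at this
      refine this.trans ?_
      rw [div_mul_eq_mul_div, div_le_iff₀ hb]
      exact mul_le_mul_of_nonneg_left hx.2 hε.le
    · rw [iteratedDeriv_succ', show deriv (fun x => F x - P.eval x) =
        fun x => deriv F x - Q.eval x from funext fun x => (hd x).deriv]
      exact (hQ k (by omega) x hx).trans (min_le_left _ _)

/-- The function `e^{-u}` is not of temperate growth on the whole line. It is replaced by `ψ₀(u/2)`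
with `ψ₀(u) = λ(u) e^{-2u}`; halving the argument ensures `λ(u/2) = 1` on all of `[-1, ∞)`. -/
theorem SchwartzMap.exists_mul_exp_neg (ψ : 𝓢(ℝ, ℂ)) (h0 : ∀ u ∈ Set.Iio (-1 : ℝ), ψ u = 0) :
    ∃ ψ' : 𝓢(ℝ, ℂ), ∀ u : ℝ, ψ' u = Complex.exp (-u) * ψ u := by
  obtain ⟨ψ₀, hψ₀⟩ := exists_schwartz_cutoff_mul_exp 2 0 (Or.inr ⟨rfl, by norm_num⟩)
  have hm := ψ₀.hasTemperateGrowth.comp_div 2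
  refine ⟨SchwartzMap.smulLeftCLM ℂ (fun u => ψ₀ (u / 2)) ψ, fun u => ?_⟩
  rw [SchwartzMap.smulLeftCLM_apply_apply hm, smul_eq_mul]
  by_cases hu : u < -1
  · rw [h0 u hu, mul_zero, mul_zero]
  · rw [hψ₀, cutoff_eq_one (by linarith)]
    congr 1
    rw [Complex.ofReal_one, one_mul]
    congr 1
    push_cast
    ring

/-- This carries approximation in `x = e^{-u}` over to Schwartz seminorms, with `C` independent of
`R`. Only `u ≥ -1` counts, where `e^{-u} ∈ (0, e]`, and the factor `e^{-u}` from each chain rule is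
absorbed into `ψ`. -/
theorem exists_bound_iteratedDeriv_mul_comp_exp_neg (i : ℕ) :
    ∀ ψ : 𝓢(ℝ, ℂ), (∀ u ∈ Set.Iio (-1 : ℝ), ψ u = 0) → ∀ k : ℕ, ∃ C, 0 ≤ C ∧
      ∀ R : ℝ → ℝ, ContDiff ℝ ∞ R → ∀ ε, 0 ≤ ε →
        (∀ j ≤ i, ∀ x ∈ Set.Icc 0 (Real.exp 1), |iteratedDeriv j R x| ≤ ε) →
        ∀ u, |u| ^ k * ‖iteratedDeriv i (fun u => ψ u * (R (Real.exp (-u)) : ℂ)) u‖ ≤ C * ε := by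
  induction i with
  | zero =>
    intro ψ h0 k
    obtain ⟨C, hC⟩ := ψ.exists_one_add_pow_bound k
    have hC0 : 0 ≤ C := le_trans (by positivity) (hC 0)
    refine ⟨C, hC0, fun R _ ε hε hR u => ?_⟩
    rw [iteratedDeriv_zero, norm_mul, Complex.norm_real]
    by_cases hu : u < -1
    · rw [h0 u hu, norm_zero, zero_mul, mul_zero]
      positivity
    · have h1 : ‖R (Real.exp (-u))‖ ≤ ε :=
        hR 0 le_rfl _ ⟨(Real.exp_pos _).le, Real.exp_le_exp.2 (by linarith)⟩
      calc _ = |u| ^ k * ‖ψ u‖ * ‖R (Real.exp (-u))‖ := by ring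
        _ ≤ (1 + |u|) ^ k * ‖ψ u‖ * ε := by
          gcongr
          linarith
        _ ≤ C * ε := by gcongr; exact hC u
  | succ i ih =>
    intro ψ h0 k
    obtain ⟨ψ', hψ'⟩ := ψ.exists_mul_exp_neg h0
    obtain ⟨C₁, hC₁, h₁⟩ := ih (SchwartzMap.derivCLM ℂ ℂ ψ)
      (fun u hu => deriv_eq_zero_of_forall_mem isOpen_Iio h0 u hu) k
    obtain ⟨C₂, hC₂, h₂⟩ := ih ψ' (fun u hu => by rw [hψ', h0 u hu, mul_zero]) k
    refine ⟨C₁ + C₂, by positivity, fun R hR ε hε hb u => ?_⟩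
    have hR' := contDiff_infty_iff_deriv.1 hR
    have hd : deriv (fun u => ψ u * (R (Real.exp (-u)) : ℂ)) = fun u =>
        (SchwartzMap.derivCLM ℂ ℂ ψ) u * (R (Real.exp (-u)) : ℂ) -
          ψ' u * ((deriv R (Real.exp (-u)) : ℝ) : ℂ) := by
      ext u
      have e1 : HasDerivAt (fun u => R (Real.exp (-u)))
          (deriv R (Real.exp (-u)) * -Real.exp (-u)) u := by
        have h3 : HasDerivAt (fun u : ℝ => Real.exp (-u)) (-Real.exp (-u)) u := by
          simpa using (hasDerivAt_neg u).exp
        exact (hR'.1 _).hasDerivAt.comp u h3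
      rw [((ψ.hasDerivAt u).fun_mul e1.ofReal_comp).deriv, SchwartzMap.derivCLM_apply, hψ']
      push_cast
      ring
    have hi : (i : WithTop ℕ∞) ≤ ∞ := mod_cast le_top
    have hc : ∀ (S : ℝ → ℝ), ContDiff ℝ ∞ S → ∀ θ : 𝓢(ℝ, ℂ),
        ContDiffAt ℝ i (fun u => θ u * (S (Real.exp (-u)) : ℂ)) u := fun S hS θ =>
      (((θ.smooth ⊤).mul (Complex.ofRealCLM.contDiff.comp
        (hS.comp (Real.contDiff_exp.comp contDiff_neg)))).of_le hi).contDiffAt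
    rw [iteratedDeriv_succ', hd, iteratedDeriv_fun_sub (hc R hR _) (hc _ hR'.2 _)]
    calc _ ≤ |u| ^ k * (_ + _) := by gcongr; exact norm_sub_le _ _
      _ ≤ C₁ * ε + C₂ * ε := by
        rw [mul_add]
        refine add_le_add (h₁ R hR ε hε (fun j hj => hb j (by omega)) u)
          (h₂ _ hR'.2 ε hε (fun j hj x hx => ?_) u)
        rw [← iteratedDeriv_succ']
        exact hb (j + 1) (by omega) x hx
      _ = _ := by ring

/-- Compact support of `φ` makes the function vanish for small `x > 0`, hence smooth at `0`. With
`F` denoting it, `φ(u) = e^{-u} F(e^{-u})`; the division by `x` accounts for the exponents `k + 1`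
starting at `1`. -/
theorem contDiff_comp_neg_log_div (φ : 𝓓((⊤ : Opens ℝ), ℝ)) :
    ContDiff ℝ ∞ (fun x : ℝ => if x ≤ 0 then 0 else φ (-Real.log x) / x) := by
  obtain ⟨R, hR⟩ := φ.hasCompactSupport.isCompact.isBounded.exists_norm_le
  rw [contDiff_iff_contDiffAt]
  intro x
  rcases le_or_gt x 0 with hx | hx
  · refine (contDiffAt_const (c := 0)).congr_of_eventuallyEq ?_
    filter_upwards [Iio_mem_nhds (hx.trans_lt (Real.exp_pos (-R)))] with y hy
    split_ifs with h
    · rfl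
    · rw [not_le] at h
      have : φ (-Real.log y) = 0 := by
        by_contra hc
        have h1 := (le_abs_self _).trans (hR _ (subset_tsupport _ hc))
        have h2 : Real.log y < -R := (Real.log_lt_iff_lt_exp h).2 hy
        linarith
      rw [this, zero_div]
  · have h1 : ContDiffAt ℝ ∞ (fun x : ℝ => φ (-Real.log x) / x) x :=
      (φ.contDiff.contDiffAt.comp x (Real.contDiffAt_log.2 hx.ne').neg).div contDiffAt_id hx.ne'
    refine h1.congr_of_eventuallyEq ?_
    filter_upwards [Ioi_mem_nhds hx] with y hy
    rw [if_neg (not_le.2 hy)]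

/-- A tempered distribution that vanishes on the functions `λ(u) e^{-ku}`, `k ≥ 1`, vanishes on
`λ φ` for all test functions `φ`. -/
theorem tempered_apply_cutoff_mul_eq_zero {T : 𝓢'(ℝ, ℂ)}
    (hT : ∀ (k : ℕ) (ψ : 𝓢(ℝ, ℂ)),
      (∀ u : ℝ, ψ u = cutoff u * Complex.exp (-((k : ℂ) + 1) * u)) → T ψ = 0)
    (φ : 𝓓((⊤ : Opens ℝ), ℝ)) :
    T (SchwartzMap.smulLeftCLM ℂ (fun u => (cutoff u : ℂ)) (testToSchwartz φ)) = 0 := by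
  obtain ⟨N, C, hC, hb⟩ := exists_order_bound T
  have hex : ∀ k : ℕ, ∃ ψ : 𝓢(ℝ, ℂ), ∀ u : ℝ, ψ u = cutoff u * Complex.exp (-((k : ℂ) + 1) * u) := by
    intro k
    obtain ⟨ψ, hψ⟩ := exists_schwartz_cutoff_mul_exp ((k : ℂ) + 1) 0
      (Or.inr ⟨rfl, by simp; positivity⟩)
    exact ⟨ψ, fun u => by rw [hψ]; simp⟩
  choose ψ hψ using hex
  have hψ0 : ∀ u ∈ Set.Iio (-1 : ℝ), ψ 0 u = 0 := fun u hu => by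
    rw [hψ, cutoff_eq_zero (le_of_lt hu), Complex.ofReal_zero, zero_mul]
  choose B hB0 hB using fun i k => exists_bound_iteratedDeriv_mul_comp_exp_neg i (ψ 0) hψ0 k
  let M : ℝ := ∑ i ∈ Finset.range (N + 1), ∑ k ∈ Finset.range (N + 1), B i k
  have hM : ∀ k ≤ N, ∀ i ≤ N, B i k ≤ M := fun k hk i hi => by
    refine le_trans ?_ (Finset.single_le_sum (f := fun i => ∑ k ∈ Finset.range (N + 1), B i k)
      (fun i _ => Finset.sum_nonneg fun k _ => hB0 _ _) (Finset.mem_range_succ_iff.2 hi))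
    exact Finset.single_le_sum (f := fun k => B i k) (fun k _ => hB0 _ _)
      (Finset.mem_range_succ_iff.2 hk)
  have hM0 : 0 ≤ M := Finset.sum_nonneg fun i _ => Finset.sum_nonneg fun k _ => hB0 _ _
  set Φ := SchwartzMap.smulLeftCLM ℂ (fun u => (cutoff u : ℂ)) (testToSchwartz φ) with hΦ
  let F : ℝ → ℝ := fun x => if x ≤ 0 then 0 else φ (-Real.log x) / x
  have hF : ContDiff ℝ ∞ F := contDiff_comp_neg_log_div φ
  have key : ∀ ε > 0, ‖T Φ‖ ≤ C * (M * ε) := by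
    intro ε hε
    obtain ⟨P, hP⟩ := exists_polynomial_iteratedDeriv_near (Real.exp_pos 1) N F hF ε hε
    -- This is `λ(u) e^{-u} P(e^{-u})`, which `T` kills, while `λ φ` is `λ(u) e^{-u} F(e^{-u})`; the
    -- difference is small because `F - P` is.
    let Ψ : 𝓢(ℝ, ℂ) := ∑ k ∈ Finset.range (P.natDegree + 1), ((P.coeff k : ℝ) : ℂ) • ψ k
    have hΨ : T Ψ = 0 := by
      rw [map_sum]
      exact Finset.sum_eq_zero fun k _ => by rw [map_smul, hT k _ (hψ k), smul_zero]
    have e : T Φ = T (Φ - Ψ) := by rw [map_sub, hΨ, sub_zero]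
    have e2 : ((Φ - Ψ : 𝓢(ℝ, ℂ)) : ℝ → ℂ) =
        fun u => ψ 0 u * ((F (Real.exp (-u)) - P.eval (Real.exp (-u)) : ℝ) : ℂ) := by
      ext u
      have hFu : F (Real.exp (-u)) = φ u * Real.exp u := by
        simp only [F]
        rw [if_neg (not_le.2 (Real.exp_pos _)), Real.log_exp, neg_neg, Real.exp_neg, div_inv_eq_mul]
      have h1 : Φ u = ψ 0 u * (F (Real.exp (-u)) : ℂ) := by
        rw [hΦ, SchwartzMap.smulLeftCLM_apply_apply cutoff_hasTemperateGrowth, hFu, hψ,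
          testToSchwartz_apply, smul_eq_mul]
        push_cast
        rw [zero_add, neg_one_mul, mul_assoc, mul_left_comm (Complex.exp _), ← Complex.exp_add,
          neg_add_cancel, Complex.exp_zero, mul_one]
      have h2 : Ψ u = ψ 0 u * ((P.eval (Real.exp (-u)) : ℝ) : ℂ) := by
        rw [Polynomial.eval_eq_sum_range]
        push_cast
        rw [Finset.mul_sum]
        simp only [Ψ]
        rw [sum_apply]
        refine Finset.sum_congr rfl fun k _ => ?_
        rw [smul_apply, hψ, hψ, smul_eq_mul, ← Complex.exp_nat_mul]
        rw [show (-((k : ℂ) + 1) * u) = -(((0 : ℕ) : ℂ) + 1) * u + k * -u by push_cast; ring,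
          Complex.exp_add]
        ring
      rw [sub_apply, h1, h2]
      push_cast
      ring
    rw [e]
    refine hb _ _ (by positivity) fun k hk i hi u => ?_
    rw [e2]
    refine (hB i k (fun x => F x - P.eval x) (hF.sub (by simpa only [Polynomial.coe_aeval_eq_eval] using P.contDiff_aeval (𝕜 := ℝ) ∞)) ε hε.le
      (fun j hj => hP j (hj.trans hi)) u).trans ?_
    gcongr
    exact hM k hk i hi
  have : ‖T Φ‖ ≤ 0 := by
    refine le_of_forall_pos_le_add fun ε hε => ?_
    refine (key (ε / (C * M + 1)) (by positivity)).trans ?_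
    rw [zero_add, ← mul_assoc, mul_div_assoc', div_le_iff₀ (by positivity)]
    nlinarith [mul_nonneg hC hM0]
  exact norm_le_zero_iff.1 this

theorem contDiff_exp_mul (ξ : ℝ) : ContDiff ℝ ∞ (fun u : ℝ => Real.exp (ξ * u)) :=
  Real.contDiff_exp.comp (contDiff_const.mul contDiff_id)

/-- A distribution is determined by its Laplace transform. -/
theorem IsInverseLaplace.unique {G : ℂ → ℂ} {g₁ g₂ : DistR} (h₁ : IsInverseLaplace 0 G g₁)
    (h₂ : IsInverseLaplace 0 G g₂) : g₁ = g₂ := by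
  have aux : ∀ g : DistR, IsInverseLaplace 0 G g → ∃ T : 𝓢'(ℝ, ℂ),
      (∀ (k : ℕ) (ψ : 𝓢(ℝ, ℂ)), (∀ u : ℝ, ψ u = cutoff u * Complex.exp (-((k : ℂ) + 1) * u)) →
        T ψ = G (k + 2)) ∧
      ∀ φ, T (SchwartzMap.smulLeftCLM ℂ (fun u => (cutoff u : ℂ))
        (testToSchwartz (testMul (fun u => Real.exp (1 * u)) φ))) = g φ := by
    intro g hg
    -- With `ξ = 1`, `T` extends `e^{-u} g`. Its value on `λ e^{-(k+1)u}` is therefore the Laplace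
    -- transform at `k + 2`, and `g` is recovered by testing `T` on `e^u φ`.
    obtain ⟨hD, T, hT⟩ := hg.1.2 1 one_pos
    refine ⟨T, fun k ψ hψ => ?_, fun φ => ?_⟩
    · have hre : ((k : ℂ) + 2).re = k + 2 := by simp
      have hL := hg.2 (k + 2) (by rw [hre]; positivity)
      refine (hL.2.2 1 one_pos (by rw [hre]; linarith [k.cast_nonneg (α := ℝ)])).2.2 T ψ hT
        fun u => ?_
      rw [hψ]
      push_cast
      ring_nf
    · have : T (testToSchwartz (testMul (fun u => Real.exp (1 * u)) φ)) = g φ := by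
        rw [hT, distMul_apply]
        congr 1
        ext u
        rw [testMul_apply (contDiff_exp_mul _), testMul_apply (contDiff_exp_mul _), ← mul_assoc,
          ← Real.exp_add]
        simp
      rw [← this]
      refine hT.apply_congr hD fun u hu => ?_
      rw [SchwartzMap.smulLeftCLM_apply_apply cutoff_hasTemperateGrowth, cutoff_eq_one hu.le,
        Complex.ofReal_one, one_smul]
  obtain ⟨T₁, hT₁, hT₁'⟩ := aux g₁ h₁
  obtain ⟨T₂, hT₂, hT₂'⟩ := aux g₂ h₂
  ext φ
  rw [← hT₁', ← hT₂', ← sub_eq_zero]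
  refine tempered_apply_cutoff_mul_eq_zero (T := T₁ - T₂) (fun k ψ hψ => ?_) _
  change T₁ ψ - T₂ ψ = 0
  rw [hT₁ k ψ hψ, hT₂ k ψ hψ, sub_self]

/-! ### The Riesz measures `u^{β-1} / Γ(β) du` on `(0, ∞)` -/

/-- The measure with density `u^{β-1} / Γ(β)` on `(0, ∞)`. -/
noncomputable def rieszMeasure (β : ℝ) : Measure ℝ :=
  (volume.restrict (Set.Ioi 0)).withDensity fun u => ENNReal.ofReal (u ^ (β - 1) / Real.Gamma β)

theorem measurable_rieszDensity (β : ℝ) :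
    Measurable fun u : ℝ => ENNReal.ofReal (u ^ (β - 1) / Real.Gamma β) :=
  ((measurable_id.pow_const _).div_const _).ennreal_ofReal

theorem rieszDensity_toReal_smul {E : Type*} [NormedAddCommGroup E] [NormedSpace ℝ E] {β : ℝ}
    (hβ : 0 < β) {u : ℝ} (hu : 0 < u) (x : E) :
    (ENNReal.ofReal (u ^ (β - 1) / Real.Gamma β)).toReal • x =
      (u ^ (β - 1) / Real.Gamma β) • x := by
  rw [ENNReal.toReal_ofReal (div_nonneg (Real.rpow_nonneg hu.le _) (Real.Gamma_pos_of_pos hβ).le)]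

theorem integral_rieszMeasure {E : Type*} [NormedAddCommGroup E] [NormedSpace ℝ E] {β : ℝ}
    (hβ : 0 < β) (f : ℝ → E) :
    ∫ u, f u ∂rieszMeasure β = ∫ u in Set.Ioi 0, (u ^ (β - 1) / Real.Gamma β) • f u := by
  rw [rieszMeasure, integral_withDensity_eq_integral_toReal_smul (measurable_rieszDensity β)
    (Filter.Eventually.of_forall fun _ => ENNReal.ofReal_lt_top)]
  exact setIntegral_congr_fun measurableSet_Ioi fun u hu => rieszDensity_toReal_smul hβ hu _

theorem integrable_rieszMeasure_iff {E : Type*} [NormedAddCommGroup E] [NormedSpace ℝ E] {β : ℝ}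
    (hβ : 0 < β) (f : ℝ → E) :
    Integrable f (rieszMeasure β) ↔
      IntegrableOn (fun u => (u ^ (β - 1) / Real.Gamma β) • f u) (Set.Ioi 0) := by
  rw [rieszMeasure, integrable_withDensity_iff_integrable_smul' (measurable_rieszDensity β)
    (Filter.Eventually.of_forall fun _ => ENNReal.ofReal_lt_top)]
  exact integrableOn_congr_fun (fun u hu => rieszDensity_toReal_smul hβ hu _) measurableSet_Ioi

theorem ae_rieszMeasure_pos (β : ℝ) : ∀ᵐ u ∂rieszMeasure β, 0 < u :=
  (withDensity_absolutelyContinuous _ _).ae_le (ae_restrict_mem measurableSet_Ioi)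

theorem integral_rieszMeasure_congr {E : Type*} [NormedAddCommGroup E] [NormedSpace ℝ E] (β : ℝ)
    {f₁ f₂ : ℝ → E} (h : ∀ u, 0 < u → f₁ u = f₂ u) :
    ∫ u, f₁ u ∂rieszMeasure β = ∫ u, f₂ u ∂rieszMeasure β :=
  integral_congr_ae ((ae_rieszMeasure_pos β).mono h)

/-- Near `0` the density is integrable because `β > 0`; at infinity a weight of order `n > β` leaves
at most a multiple of `u^{β-1-n}`, with exponent below `-1`. -/
theorem rieszMeasure_hasTemperateGrowth {β : ℝ} (hβ : 0 < β) :
    (rieszMeasure β).HasTemperateGrowth := by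
  obtain ⟨n, hn⟩ := exists_nat_gt β
  refine ⟨n, ?_⟩
  have hΓ := Real.Gamma_pos_of_pos hβ
  rw [integrable_rieszMeasure_iff hβ, ← Set.Ioc_union_Ioi_eq_Ioi zero_le_one]
  have hm : Measurable fun u : ℝ =>
      (u ^ (β - 1) / Real.Gamma β) • (1 + ‖u‖) ^ (-(n : ℝ)) :=
    ((measurable_id.pow_const _).div_const _).smul
      ((measurable_const.add measurable_norm).pow_const _)
  refine IntegrableOn.union ?_ ?_
  · have h1 : IntegrableOn (fun u : ℝ => u ^ (β - 1)) (Set.Ioc 0 1) :=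
      (intervalIntegrable_iff_integrableOn_Ioc_of_le zero_le_one).1
        (intervalIntegral.intervalIntegrable_rpow' (by linarith))
    refine Integrable.mono' (h1.div_const (Real.Gamma β)) hm.aestronglyMeasurable ?_
    filter_upwards [ae_restrict_mem measurableSet_Ioc] with u hu
    have hp := Real.rpow_nonneg hu.1.le (β - 1)
    rw [smul_eq_mul, norm_mul, Real.norm_of_nonneg (by positivity),
      Real.norm_of_nonneg (by positivity)]
    refine mul_le_of_le_one_right (by positivity) ?_
    exact Real.rpow_le_one_of_one_le_of_nonpos (by linarith [norm_nonneg u]) (by simp)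
  · have h1 : IntegrableOn (fun u : ℝ => u ^ (β - 1 - n)) (Set.Ioi 1) :=
      integrableOn_Ioi_rpow_of_lt (by linarith) one_pos
    refine Integrable.mono' (h1.div_const (Real.Gamma β)) hm.aestronglyMeasurable ?_
    filter_upwards [ae_restrict_mem measurableSet_Ioi] with u hu
    have hu0 : 0 < u := one_pos.trans hu
    have hp := Real.rpow_nonneg hu0.le (β - 1)
    rw [smul_eq_mul, norm_mul, Real.norm_of_nonneg (by positivity),
      Real.norm_of_nonneg (by positivity), sub_eq_add_neg (β - 1), Real.rpow_add hu0,
      div_mul_eq_mul_div]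
    gcongr ?_ * ?_ / _
    exact Real.rpow_le_rpow_of_nonpos hu0 (by rw [Real.norm_of_nonneg hu0.le]; linarith) (by simp)

/-- The `n`-th distributional derivative of the Riesz measure `u^{β-1} / Γ(β) du`. -/
noncomputable def rieszDist {β : ℝ} (hβ : 0 < β) : ℕ → 𝓢'(ℝ, ℂ)
  | 0 => haveI := rieszMeasure_hasTemperateGrowth hβ
    (rieszMeasure β).toTemperedDistribution
  | n + 1 => TemperedDistribution.derivCLM ℂ (rieszDist hβ n)

theorem rieszDist_zero_apply {β : ℝ} (hβ : 0 < β) (ψ : 𝓢(ℝ, ℂ)) :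
    rieszDist hβ 0 ψ = ∫ u, ψ u ∂rieszMeasure β := rfl

theorem rieszDist_succ_apply {β : ℝ} (hβ : 0 < β) (n : ℕ) (ψ : 𝓢(ℝ, ℂ)) :
    rieszDist hβ (n + 1) ψ = -rieszDist hβ n (SchwartzMap.derivCLM ℂ ℂ ψ) := by
  rw [← map_neg]
  rfl

/-- A derivative at `u > 0` sees only values near `u`. Later computations can thus ignore the
cutoff, which equals `1` there. -/
theorem rieszDist_congr {β : ℝ} (hβ : 0 < β) (n : ℕ) :
    ∀ {ψ₁ ψ₂ : 𝓢(ℝ, ℂ)}, (∀ u, 0 < u → ψ₁ u = ψ₂ u) → rieszDist hβ n ψ₁ = rieszDist hβ n ψ₂ := by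
  induction n with
  | zero => exact fun h => integral_rieszMeasure_congr β h
  | succ n ih =>
    intro ψ₁ ψ₂ h
    rw [rieszDist_succ_apply, rieszDist_succ_apply, ih fun u hu => ?_]
    rw [SchwartzMap.derivCLM_apply, SchwartzMap.derivCLM_apply]
    exact Filter.EventuallyEq.deriv_eq (Filter.eventually_of_mem (Ioi_mem_nhds hu) h)

theorem integrable_rieszMeasure_schwartz {β : ℝ} (hβ : 0 < β) (ψ : 𝓢(ℝ, ℂ)) :
    Integrable ψ (rieszMeasure β) :=
  haveI := rieszMeasure_hasTemperateGrowth hβ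
  ψ.integrable

/-- Integration by parts with `(u^β/Γ(β+1))' = u^{β-1}/Γ(β)`: the boundary term vanishes at `0`
because `β > 0`, and at infinity by integrability. It follows that raising `n` and `β` together by
one leaves the distribution unchanged. -/
theorem rieszDist_one_add_one {β : ℝ} (hβ : 0 < β) (hβ' : 0 < β + 1) (ψ : 𝓢(ℝ, ℂ)) :
    rieszDist hβ' 1 ψ = rieszDist hβ 0 ψ := by
  rw [rieszDist_succ_apply, rieszDist_zero_apply, rieszDist_zero_apply, integral_rieszMeasure hβ,
    integral_rieszMeasure hβ']
  have i₀ := (integrable_rieszMeasure_iff hβ _).1 (integrable_rieszMeasure_schwartz hβ ψ)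
  have i₁ := (integrable_rieszMeasure_iff hβ' _).1 (integrable_rieszMeasure_schwartz hβ' ψ)
  have i₂ := (integrable_rieszMeasure_iff hβ' _).1
    (integrable_rieszMeasure_schwartz hβ' (SchwartzMap.derivCLM ℂ ℂ ψ))
  have hd : ∀ u ∈ Set.Ioi (0 : ℝ),
      HasDerivAt (fun u : ℝ => (u ^ (β + 1 - 1) / Real.Gamma (β + 1)) • ψ u)
        ((u ^ (β + 1 - 1) / Real.Gamma (β + 1)) • (SchwartzMap.derivCLM ℂ ℂ ψ) u +
          (u ^ (β - 1) / Real.Gamma β) • ψ u) u := by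
    intro u hu
    have h1 : HasDerivAt (fun u : ℝ => u ^ (β + 1 - 1) / Real.Gamma (β + 1))
        (u ^ (β - 1) / Real.Gamma β) u := by
      have := (Real.hasDerivAt_rpow_const (x := u) (p := β + 1 - 1)
        (Or.inl (ne_of_gt hu))).div_const (Real.Gamma (β + 1))
      convert! this using 1
      rw [Real.Gamma_add_one hβ.ne', add_sub_cancel_right]
      have := (Real.Gamma_pos_of_pos hβ).ne'
      field_simp
    exact h1.smul (ψ.hasDerivAt u)
  have hlim := tendsto_zero_of_hasDerivAt_of_integrableOn_Ioi hd (i₂.add i₀) i₁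
  have hc : ContinuousWithinAt (fun u : ℝ => (u ^ (β + 1 - 1) / Real.Gamma (β + 1)) • ψ u)
      (Set.Ici 0) 0 := by
    have h1 : ContinuousAt (fun u : ℝ => u ^ (β + 1 - 1) / Real.Gamma (β + 1)) 0 :=
      (Real.continuousAt_rpow_const _ _ (Or.inr (by linarith))).div_const _
    exact (h1.fun_smul ψ.continuous.continuousAt).continuousWithinAt
  have h := integral_Ioi_of_hasDerivAt_of_tendsto hc hd (i₂.add i₀) hlim
  rw [integral_add i₂ i₀, add_sub_cancel_right, Real.zero_rpow hβ.ne', zero_div, zero_smul,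
    sub_zero] at h
  rw [add_sub_cancel_right]
  exact neg_eq_of_add_eq_zero_right h

theorem rieszDist_succ_add_one {β : ℝ} (hβ : 0 < β) (hβ' : 0 < β + 1) (n : ℕ) :
    ∀ ψ : 𝓢(ℝ, ℂ), rieszDist hβ' (n + 1) ψ = rieszDist hβ n ψ := by
  induction n with
  | zero => exact rieszDist_one_add_one hβ hβ'
  | succ n ih =>
    intro ψ
    rw [rieszDist_succ_apply, ih, ← rieszDist_succ_apply]

/-- `u g_α = -α g_{α-1}` for `g_α = D^n (u^{β-1} / Γ(β))`, `α = n - β`. -/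
theorem rieszDist_mul_id {β : ℝ} (hβ : 0 < β) (hβ' : 0 < β + 1) (n : ℕ) :
    ∀ ψ Θ : 𝓢(ℝ, ℂ), (∀ u, 0 < u → Θ u = u * ψ u) →
      rieszDist hβ n Θ = -((n : ℂ) - β) * rieszDist hβ' n ψ := by
  induction n with
  | zero =>
    intro ψ Θ h
    rw [rieszDist_zero_apply, rieszDist_zero_apply, integral_rieszMeasure hβ,
      integral_rieszMeasure hβ', Nat.cast_zero, zero_sub, neg_neg, ← integral_const_mul]
    refine setIntegral_congr_fun measurableSet_Ioi fun u hu => ?_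
    have hu0 : (0 : ℝ) < u := hu
    have e : u ^ (β + 1 - 1) = u ^ (β - 1) * u := by
      rw [← Real.rpow_add_one hu0.ne']
      ring_nf
    simp only [h u hu0, e, Real.Gamma_add_one hβ.ne', Complex.real_smul]
    push_cast
    have h1 : (Real.Gamma β : ℂ) ≠ 0 := by exact_mod_cast (Real.Gamma_pos_of_pos hβ).ne'
    have h2 : (β : ℂ) ≠ 0 := by exact_mod_cast hβ.ne'
    field_simp
  | succ n ih =>
    intro ψ Θ h
    let Λ : 𝓢(ℝ, ℂ) := SchwartzMap.smulLeftCLM ℂ (fun u : ℝ => (u : ℂ))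
      (SchwartzMap.derivCLM ℂ ℂ ψ)
    have hid : (fun u : ℝ => (u : ℂ)).HasTemperateGrowth := Complex.ofRealCLM.hasTemperateGrowth
    have hΛ : ∀ u, Λ u = u * deriv ψ u := fun u => by
      simp only [Λ]
      rw [SchwartzMap.smulLeftCLM_apply_apply hid, SchwartzMap.derivCLM_apply, smul_eq_mul]
    have h1 : rieszDist hβ n (SchwartzMap.derivCLM ℂ ℂ Θ) = rieszDist hβ n (ψ + Λ) := by
      refine rieszDist_congr hβ n fun u hu => ?_
      have e1 : HasDerivAt (fun u : ℝ => (u : ℂ) * ψ u) (1 * ψ u + u * deriv ψ u) u :=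
        (Complex.ofRealCLM.hasDerivAt).fun_mul (ψ.hasDerivAt u)
      rw [SchwartzMap.derivCLM_apply, add_apply, hΛ, Filter.EventuallyEq.deriv_eq
        (Filter.eventually_of_mem (Ioi_mem_nhds hu) h), e1.deriv, one_mul]
    have h2 := ih (SchwartzMap.derivCLM ℂ ℂ ψ) Λ fun u _ => by
      rw [hΛ, SchwartzMap.derivCLM_apply]
    -- From `(uψ)' = ψ + uψ'`: the first term is shifted to `(n + 1, β + 1)`, so that both become
    -- multiples of the same value.
    rw [rieszDist_succ_apply, h1, map_add, h2, ← rieszDist_succ_add_one hβ hβ' n ψ,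
      rieszDist_succ_apply]
    push_cast
    ring

/-! ### Laplace transforms of powers -/

theorem integral_exp_neg_mul_rieszMeasure_ofReal {β : ℝ} (hβ : 0 < β) {s : ℝ} (hs : 0 < s) :
    ∫ u, Real.exp (s * -u) ∂rieszMeasure β = s ^ (-β) := by
  have hΓ := (Real.Gamma_pos_of_pos hβ).ne'
  rw [integral_rieszMeasure hβ]
  have : ∀ u : ℝ, (u ^ (β - 1) / Real.Gamma β) • Real.exp (s * -u) =
      (Real.Gamma β)⁻¹ * (u ^ (β - 1) * Real.exp (-(s * u))) := fun u => by
    rw [smul_eq_mul, mul_neg]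
    ring
  simp_rw [this]
  rw [integral_const_mul, Real.integral_rpow_mul_exp_neg_mul_Ioi hβ hs, one_div,
    Real.inv_rpow hs.le, ← Real.rpow_neg hs.le]
  field_simp

theorem integrable_exp_neg_mul_rieszMeasure {β : ℝ} (hβ : 0 < β) {s : ℝ} (hs : 0 < s) :
    Integrable (fun u => Real.exp (s * -u)) (rieszMeasure β) := by
  rw [integrable_rieszMeasure_iff hβ]
  have := (integrableOn_rpow_mul_exp_neg_mul_rpow (s := β - 1) (p := 1) (by linarith)
    one_pos hs).div_const (Real.Gamma β)
  refine IntegrableOn.congr_fun this (fun u _ => ?_) measurableSet_Ioi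
  simp only [Real.rpow_one, smul_eq_mul]
  rw [mul_neg, neg_mul]
  ring

/-- Both sides are analytic on the right half-plane and agree at positive reals, which accumulate at
`1`; the identity theorem gives the rest. -/
theorem integral_exp_neg_mul_rieszMeasure {β : ℝ} (hβ : 0 < β) {s : ℂ} (hs : 0 < s.re) :
    ∫ u : ℝ, Complex.exp (-s * u) ∂rieszMeasure β = s ^ (-β : ℂ) := by
  let U : Set ℂ := {z | 0 < z.re}
  have hU : IsOpen U := isOpen_lt continuous_const Complex.continuous_re
  have hset : ∀ z ∈ U, z.re ∈ interior (integrableExpSet (fun u : ℝ => -u) (rieszMeasure β)) :=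
    fun z hz => mem_interior.2 ⟨Set.Ioi 0,
      fun s hs => integrable_exp_neg_mul_rieszMeasure hβ hs, isOpen_Ioi, hz⟩
  have h1 : AnalyticOnNhd ℂ (complexMGF (fun u : ℝ => -u) (rieszMeasure β)) U :=
    fun z hz => analyticAt_complexMGF (hset z hz)
  have h2 : AnalyticOnNhd ℂ (fun z : ℂ => z ^ (-β : ℂ)) U := fun z hz =>
    analyticAt_id.cpow analyticAt_const (Or.inl hz)
  have hconv : IsPreconnected U := (convex_halfSpace_re_gt 0).isPreconnected
  have hf : ∃ᶠ z in nhdsWithin (1 : ℂ) {1}ᶜ,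
      complexMGF (fun u : ℝ => -u) (rieszMeasure β) z = z ^ (-β : ℂ) := by
    have ht : Filter.Tendsto (fun r : ℝ => (r : ℂ)) (nhdsWithin 1 {1}ᶜ)
        (nhdsWithin (1 : ℂ) {1}ᶜ) := by
      refine tendsto_nhdsWithin_iff.2 ⟨?_, ?_⟩
      · exact (Complex.continuous_ofReal.tendsto' 1 1 Complex.ofReal_one).mono_left
          nhdsWithin_le_nhds
      · filter_upwards [self_mem_nhdsWithin] with r hr
        simpa using hr
    refine ht.frequently (Filter.Eventually.frequently ?_)
    filter_upwards [nhdsWithin_le_nhds (Ioi_mem_nhds (zero_lt_one' ℝ))] with r hr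
    rw [complexMGF_ofReal, mgf, integral_exp_neg_mul_rieszMeasure_ofReal hβ hr,
      Complex.ofReal_cpow (le_of_lt hr), Complex.ofReal_neg]
  have h := h1.eqOn_of_preconnected_of_frequently_eq h2 hconv (by simp [U]) hf hs
  beta_reduce at h
  rw [← h, complexMGF]
  simp

/-- Each distributional derivative contributes a factor `s`, since `-(e^{-su})' = s e^{-su}`. -/
theorem rieszDist_cutoff_mul_exp {β : ℝ} (hβ : 0 < β) (n : ℕ) {s : ℂ} (hs : 0 < s.re) :
    ∀ ψ : 𝓢(ℝ, ℂ), (∀ u, 0 < u → ψ u = Complex.exp (-s * u)) →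
      rieszDist hβ n ψ = s ^ ((n : ℂ) - β) := by
  have hs0 : s ≠ 0 := fun h => by simp [h] at hs
  induction n with
  | zero =>
    intro ψ hψ
    rw [rieszDist_zero_apply, integral_rieszMeasure_congr β hψ,
      integral_exp_neg_mul_rieszMeasure hβ hs, Nat.cast_zero, zero_sub]
  | succ n ih =>
    intro ψ hψ
    rw [rieszDist_succ_apply, ← map_neg,
      rieszDist_congr hβ n (ψ₂ := s • ψ) fun u hu => ?_, map_smul, ih ψ hψ, smul_eq_mul]
    · rw [show ((n + 1 : ℕ) : ℂ) - β = 1 + (n - β) by push_cast; ring, Complex.cpow_add _ _ hs0,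
        Complex.cpow_one]
    · rw [neg_apply, SchwartzMap.derivCLM_apply, smul_apply, hψ u hu,
        Filter.EventuallyEq.deriv_eq (Filter.eventually_of_mem (Ioi_mem_nhds hu) hψ)]
      have e1 : HasDerivAt (fun u : ℝ => Complex.exp (-s * u)) (Complex.exp (-s * u) * (-s * 1)) u :=
        (Complex.ofRealCLM.hasDerivAt.const_mul (-s)).cexp
      rw [e1.deriv, smul_eq_mul]
      ring

theorem restrictDist_rieszDist_mem_DPlus {β : ℝ} (hβ : 0 < β) (n : ℕ) :
    restrictDist (rieszDist hβ n) ∈ DPlus := by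
  intro φ hφ
  rw [← extends_restrictDist, ← map_zero (rieszDist hβ n)]
  refine rieszDist_congr hβ n fun u hu => ?_
  rw [testToSchwartz_apply, image_eq_zero_of_notMem_tsupport fun h => lt_asymm hu (hφ h)]
  rfl

theorem exp_neg_mul_cutoff_hasTemperateGrowth {ξ c : ℝ} (h : 0 < c ∨ c = 0 ∧ 0 < ξ) :
    (fun u => (cutoff u : ℂ) * (Real.exp (-ξ * u - c * u ^ 2) : ℝ)).HasTemperateGrowth := by
  obtain ⟨ψ, hψ⟩ := exists_schwartz_cutoff_mul_exp ξ c (by simpa using h)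
  have := ψ.hasTemperateGrowth
  rwa [funext hψ, show (fun u : ℝ => (cutoff u : ℂ) * Complex.exp (-ξ * u - c * u ^ 2)) =
    fun u => (cutoff u : ℂ) * (Real.exp (-ξ * u - c * u ^ 2) : ℝ) by ext u; push_cast; rfl] at this

theorem isInverseLaplace_rieszDist {β : ℝ} (hβ : 0 < β) (n : ℕ) :
    IsInverseLaplace 0 (fun s : ℂ => s ^ ((n : ℂ) - β)) (restrictDist (rieszDist hβ n)) := by
  have hD := restrictDist_rieszDist_mem_DPlus hβ n
  have hE := extends_restrictDist (rieszDist hβ n)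
  have hm : ∀ ξ : ℝ, 0 < ξ →
      (fun u => (cutoff u : ℂ) * (Real.exp (-ξ * u) : ℝ)).HasTemperateGrowth := fun ξ hξ => by
    simpa using exp_neg_mul_cutoff_hasTemperateGrowth (ξ := ξ) (c := 0) (Or.inr ⟨rfl, hξ⟩)
  have hDE : restrictDist (rieszDist hβ n) ∈ DPlusExp 0 := ⟨hD, fun ξ hξ =>
    distMul_mem_SPlus ⟨hD, _, hE⟩ (contDiff_exp_mul _) (hm ξ hξ)⟩
  refine ⟨hDE, fun s hs => ⟨hDE, hs, fun ξ hξ hξs => ?_⟩⟩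
  obtain ⟨Φ, hΦ⟩ := exists_schwartz_cutoff_mul_exp s 0 (Or.inr ⟨rfl, hs⟩)
  obtain ⟨ψ, hψ⟩ := exists_schwartz_cutoff_mul_exp (s - ξ) 0 (Or.inr ⟨rfl, by simpa using hξs⟩)
  beta_reduce
  rw [← rieszDist_cutoff_mul_exp hβ n hs Φ fun u hu => by
    rw [hΦ, cutoff_eq_one (by linarith)]; simp]
  refine hasPairing_distMul hE hD (contDiff_exp_mul _) (hm ξ hξ)
    ⟨ψ, fun u => by rw [hψ]; simp⟩ fun u hu => ?_
  rw [hΦ, cutoff_eq_one hu.le, Complex.ofReal_exp, ← Complex.exp_add, Complex.ofReal_one, one_mul]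
  congr 1
  push_cast
  ring

/-! ### Kummer's function and the recurrence for parabolic cylinder functions -/

theorem ascPochhammer_eval_succ_left (n : ℕ) (a : ℝ) :
    (ascPochhammer ℝ (n + 1)).eval a = a * (ascPochhammer ℝ n).eval (a + 1) := by
  rw [ascPochhammer_succ_left]
  simp

/-- Ratio test: `|a + n| ≤ (|a|/b + 1)(b + n)`, so the ratio of consecutive terms is `O(1/n)`. -/
theorem summable_kummerM (a z : ℝ) {b : ℝ} (hb : 0 < b) :
    Summable fun n : ℕ => ((ascPochhammer ℝ n).eval a * z ^ n) /
      ((ascPochhammer ℝ n).eval b * n.factorial) := by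
  refine summable_of_ratio_norm_eventually_le (r := 1 / 2) (by norm_num) ?_
  obtain ⟨N, hN⟩ := exists_nat_ge (2 * (|a| / b + 1) * |z|)
  filter_upwards [Filter.eventually_ge_atTop N] with n hn
  have hn' : (N : ℝ) ≤ n := by exact_mod_cast hn
  have hn0 : (0 : ℝ) ≤ n := n.cast_nonneg
  have hp : 0 < (ascPochhammer ℝ n).eval b := ascPochhammer_pos n b hb
  have hf : (0 : ℝ) < n.factorial := by exact_mod_cast n.factorial_pos
  have e : ((ascPochhammer ℝ (n + 1)).eval a * z ^ (n + 1)) /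
      ((ascPochhammer ℝ (n + 1)).eval b * (n + 1).factorial) =
      ((a + n) * z / ((b + n) * (n + 1))) * (((ascPochhammer ℝ n).eval a * z ^ n) /
      ((ascPochhammer ℝ n).eval b * n.factorial)) := by
    rw [ascPochhammer_succ_eval, ascPochhammer_succ_eval, Nat.factorial_succ]
    push_cast
    field_simp
    ring
  rw [e, norm_mul]
  refine mul_le_mul_of_nonneg_right ?_ (norm_nonneg _)
  rw [Real.norm_eq_abs, abs_div, abs_mul, abs_of_pos (show 0 < (b + n) * (n + 1) by positivity),
    div_le_iff₀ (by positivity)]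
  have h1 : |a + n| ≤ (|a| / b + 1) * (b + n) := by
    calc |a + n| ≤ |a| + n := (abs_add_le _ _).trans (by rw [Nat.abs_cast])
      _ ≤ |a| + n + (|a| / b * n + b) := le_add_of_nonneg_right (by positivity)
      _ = (|a| / b + 1) * (b + n) := by field_simp; ring
  calc |a + n| * |z| ≤ (|a| / b + 1) * (b + n) * |z| := by gcongr
    _ = (b + n) * ((|a| / b + 1) * |z|) := by ring
    _ ≤ (b + n) * ((n + 1) / 2) := by gcongr; linarith
    _ = _ := by ring

theorem kummerM_sub_one_left (a z : ℝ) {b : ℝ} (hb : 0 < b) :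
    kummerM a b z - kummerM (a - 1) b z = z / b * kummerM a (b + 1) z := by
  unfold kummerM
  rw [← (summable_kummerM a z hb).tsum_sub (summable_kummerM (a - 1) z hb),
    ((summable_kummerM a z hb).sub (summable_kummerM (a - 1) z hb)).tsum_eq_zero_add,
    ← tsum_mul_left]
  simp only [ascPochhammer_zero, Polynomial.eval_one, sub_self, zero_add]
  refine tsum_congr fun n => ?_
  have hp : (ascPochhammer ℝ n).eval (b + 1) ≠ 0 := (ascPochhammer_pos n _ (by linarith)).ne'
  have hf : (n.factorial : ℝ) ≠ 0 := by exact_mod_cast n.factorial_ne_zero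
  rw [ascPochhammer_succ_eval n a, ascPochhammer_eval_succ_left n (a - 1), sub_add_cancel,
    ascPochhammer_eval_succ_left n b, Nat.factorial_succ]
  push_cast
  field_simp
  ring

theorem kummerM_contiguous (a z : ℝ) {b : ℝ} (hb : 0 < b) :
    b * kummerM a b z = (b - a) * kummerM a (b + 1) z + a * kummerM (a + 1) (b + 1) z := by
  have hb' : 0 < b + 1 := by linarith
  unfold kummerM
  rw [← tsum_mul_left, ← tsum_mul_left, ← tsum_mul_left,
    ← ((summable_kummerM a z hb').mul_left (b - a)).tsum_add
      ((summable_kummerM (a + 1) z hb').mul_left a)]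
  refine tsum_congr fun n => ?_
  have hp : (ascPochhammer ℝ n).eval (b + 1) ≠ 0 := (ascPochhammer_pos n _ hb').ne'
  have hp' : (ascPochhammer ℝ n).eval b ≠ 0 := (ascPochhammer_pos n _ hb).ne'
  have hf : (n.factorial : ℝ) ≠ 0 := by exact_mod_cast n.factorial_ne_zero
  have h1 : (ascPochhammer ℝ n).eval b * (b + n) = b * (ascPochhammer ℝ n).eval (b + 1) := by
    rw [← ascPochhammer_succ_eval, ascPochhammer_eval_succ_left]
  have h2 : (ascPochhammer ℝ n).eval a * (a + n) = a * (ascPochhammer ℝ n).eval (a + 1) := by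
    rw [← ascPochhammer_succ_eval, ascPochhammer_eval_succ_left]
  rw [← mul_div_assoc, ← mul_div_assoc, ← mul_div_assoc, ← add_div, div_eq_div_iff (by positivity)
    (by positivity)]
  linear_combination (-(ascPochhammer ℝ n).eval a * z ^ n * n.factorial) * h1 +
    z ^ n * (ascPochhammer ℝ n).eval b * n.factorial * h2

/-- The functional equation of the entire function `1/Γ`. At `s = 0` it relies on the convention
`Γ(0) = 0`, so the recurrence below needs no exceptional orders. -/
theorem inv_Gamma_eq_mul_inv_Gamma_add_one (s : ℝ) :
    (Real.Gamma s)⁻¹ = s * (Real.Gamma (s + 1))⁻¹ := by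
  rcases eq_or_ne s 0 with rfl | h
  · simp [Real.Gamma_zero]
  · rw [Real.Gamma_add_one h, mul_inv, ← mul_assoc, mul_inv_cancel₀ h, one_mul]

/-- The parts even and odd in `z` separate: once the Gamma factors are aligned, the even part is the
Kummer relation `K1` and the odd part is `K2`. -/
theorem parabolicCylinderD_add_one (α z : ℝ) :
    parabolicCylinderD (α + 1) z =
      z * parabolicCylinderD α z - α * parabolicCylinderD (α - 1) z := by
  have hs : √2 * √2 = (2 : ℝ) := Real.mul_self_sqrt (by norm_num)
  have hs0 : √(2 : ℝ) ≠ 0 := by positivity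
  have p1 : (2 : ℝ) ^ ((α + 1) / 2) = 2 ^ (α / 2) * √2 := by
    rw [add_div, Real.rpow_add two_pos, Real.sqrt_eq_rpow]
  have p2 : (2 : ℝ) ^ ((α - 1) / 2) = 2 ^ (α / 2) * (√2 / 2) := by
    rw [sub_div, Real.rpow_sub two_pos, ← Real.sqrt_eq_rpow]
    field_simp
    rw [sq, hs]
  have K1 := kummerM_sub_one_left (-α / 2 + 1 / 2) (z ^ 2 / 2) (b := 1 / 2) (by norm_num)
  have K2 := kummerM_contiguous (-α / 2) (z ^ 2 / 2) (b := 1 / 2) (by norm_num)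
  have G1 := inv_Gamma_eq_mul_inv_Gamma_add_one (-α / 2)
  have G2 := inv_Gamma_eq_mul_inv_Gamma_add_one (-α / 2 - 1 / 2)
  unfold parabolicCylinderD
  rw [p1, p2, Real.sqrt_mul (by norm_num : (0 : ℝ) ≤ 2)]
  rw [show (1 - (α + 1)) / 2 = -α / 2 by ring, show -(α + 1) / 2 = -α / 2 - 1 / 2 by ring,
    show 1 / 2 - (α + 1) / 2 = -α / 2 by ring, show (1 - (α - 1)) / 2 = -α / 2 + 1 by ring,
    show -(α - 1) / 2 = -α / 2 + 1 / 2 by ring, show 1 / 2 - (α - 1) / 2 = -α / 2 + 1 by ring,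
    show (1 - α) / 2 = -α / 2 + 1 / 2 by ring, show 1 / 2 - α / 2 = -α / 2 + 1 / 2 by ring]
  rw [show -α / 2 + 1 / 2 - 1 = -α / 2 - 1 / 2 by ring,
    show (1 / 2 : ℝ) + 1 = 3 / 2 by norm_num] at K1
  rw [show (1 / 2 : ℝ) + 1 = 3 / 2 by norm_num] at K2
  rw [show -α / 2 - 1 / 2 + 1 = -α / 2 + 1 / 2 by ring] at G2
  rw [G1, G2]
  generalize (Real.Gamma (-α / 2 + 1))⁻¹ = g at *
  generalize (Real.Gamma (-α / 2 + 1 / 2))⁻¹ = g' at *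
  generalize kummerM (-α / 2 - 1 / 2) (1 / 2) (z ^ 2 / 2) = M1 at *
  generalize kummerM (-α / 2) (3 / 2) (z ^ 2 / 2) = M2 at *
  generalize kummerM (-α / 2) (1 / 2) (z ^ 2 / 2) = M3 at *
  generalize kummerM (-α / 2 + 1 / 2) (3 / 2) (z ^ 2 / 2) = M4 at *
  generalize kummerM (-α / 2 + 1 / 2) (1 / 2) (z ^ 2 / 2) = M5 at *
  generalize kummerM (-α / 2 + 1) (3 / 2) (z ^ 2 / 2) = M6 at *
  generalize (2 : ℝ) ^ (α / 2) = p
  generalize Real.exp (-z ^ 2 / 4) = e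
  generalize √(2 : ℝ) = s at *
  generalize √Real.pi = q
  linear_combination (-(p * s * e * q * (-α / 2) * g)) * K1 - 2 * p * e * q * z * g' * K2 +
    p * e * q * z * g' * (-(-α / 2 - 1 / 2) * M2 - α / 2 * M6) * hs

theorem powerParabolicCylinder_add_one (α x : ℝ) {t : ℝ} (ht : 0 < t) :
    powerParabolicCylinder (α + 1) x t =
      x * powerParabolicCylinder α x t - t * α * powerParabolicCylinder (α - 1) x t := by
  have hs : √t * √t = t := Real.mul_self_sqrt ht.le
  have hs0 : √t ≠ 0 := (Real.sqrt_pos.2 ht).ne'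
  have p1 : t ^ ((α + 1) / 2) = t ^ (α / 2) * √t := by
    rw [add_div, Real.rpow_add ht, Real.sqrt_eq_rpow]
  have p2 : t ^ ((α - 1) / 2) = t ^ (α / 2) / √t := by
    rw [sub_div, Real.rpow_sub ht, Real.sqrt_eq_rpow]
  unfold powerParabolicCylinder
  rw [parabolicCylinderD_add_one, p1, p2]
  generalize parabolicCylinderD α (x / √t) = D
  generalize parabolicCylinderD (α - 1) (x / √t) = D'
  generalize Real.exp (x ^ 2 / (4 * t)) = e
  generalize t ^ (α / 2) = p
  have h1 : t * (p / √t) = p * √t := by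
    rw [mul_div_assoc', div_eq_iff hs0]
    linear_combination -p * hs
  have h2 : √t * (x / √t) = x := mul_div_cancel₀ x hs0
  linear_combination p * e * D * h2 + α * e * D' * h1

/-! ### Negative orders -/

theorem Real.Gamma_add_nat_eq_mul_ascPochhammer {a : ℝ} (ha : 0 < a) (m : ℕ) :
    Real.Gamma (a + m) = Real.Gamma a * (ascPochhammer ℝ m).eval a := by
  induction m with
  | zero => simp
  | succ m ih =>
    rw [ascPochhammer_succ_eval, Nat.cast_succ, ← add_assoc, Real.Gamma_add_one (by positivity), ih]
    ring

theorem two_mul_factorial_eq_ascPochhammer (m : ℕ) :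
    ((2 * m).factorial : ℝ) = 4 ^ m * m.factorial * (ascPochhammer ℝ m).eval (1 / 2) := by
  induction m with
  | zero => simp
  | succ m ih =>
    rw [show 2 * (m + 1) = 2 * m + 1 + 1 by ring, Nat.factorial_succ, Nat.factorial_succ,
      ascPochhammer_succ_eval, Nat.factorial_succ]
    push_cast
    rw [ih]
    ring

theorem two_mul_add_one_factorial_eq_ascPochhammer (m : ℕ) :
    ((2 * m + 1).factorial : ℝ) = 4 ^ m * m.factorial * (ascPochhammer ℝ m).eval (3 / 2) := by
  have h : (ascPochhammer ℝ m).eval (1 / 2) * (1 / 2 + m) =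
      1 / 2 * (ascPochhammer ℝ m).eval (3 / 2 : ℝ) := by
    rw [← ascPochhammer_succ_eval, ascPochhammer_eval_succ_left]
    norm_num
  rw [Nat.factorial_succ]
  push_cast
  rw [two_mul_factorial_eq_ascPochhammer]
  linear_combination 2 * 4 ^ m * m.factorial * h

/-- The Gaussian moments `∫ u^k / k! · e^{-tu²/2} · u^{β-1} / Γ(β) du` over `(0, ∞)`. -/
noncomputable def rieszGaussianMoment (β t : ℝ) (k : ℕ) : ℝ :=
  (t / 2) ^ (-(β + k) / 2) * (1 / 2) * Real.Gamma ((β + k) / 2) / (k.factorial * Real.Gamma β)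

theorem integral_pow_mul_gaussian_rieszMeasure {β t : ℝ} (hβ : 0 < β) (ht : 0 < t) (k : ℕ) :
    ∫ u, u ^ k / k.factorial * Real.exp (-(t / 2) * u ^ 2) ∂rieszMeasure β =
      rieszGaussianMoment β t k := by
  have h := integral_rpow_mul_exp_neg_mul_rpow (p := 2) (q := β - 1 + k) (b := t / 2) two_pos
    (by linarith [k.cast_nonneg (α := ℝ)]) (by positivity)
  rw [show β - 1 + (k : ℝ) + 1 = β + k by ring] at h
  have e : rieszGaussianMoment β t k = (k.factorial * Real.Gamma β : ℝ)⁻¹ *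
      ((t / 2) ^ (-(β + k) / 2) * (1 / 2) * Real.Gamma ((β + k) / 2)) := by
    rw [rieszGaussianMoment]
    ring
  rw [integral_rieszMeasure hβ, e, ← h, ← integral_const_mul]
  refine setIntegral_congr_fun measurableSet_Ioi fun u hu => ?_
  rw [Real.rpow_add hu, Real.rpow_natCast, Real.rpow_two, smul_eq_mul, mul_inv]
  ring

theorem integrable_pow_mul_gaussian_rieszMeasure {β t : ℝ} (hβ : 0 < β) (ht : 0 < t) (k : ℕ) :
    Integrable (fun u => u ^ k / k.factorial * Real.exp (-(t / 2) * u ^ 2)) (rieszMeasure β) := by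
  rw [integrable_rieszMeasure_iff hβ]
  have h := (integrableOn_rpow_mul_exp_neg_mul_sq (b := t / 2) (by positivity)
    (s := β - 1 + k) (by linarith [k.cast_nonneg (α := ℝ)])).const_mul
    ((k.factorial * Real.Gamma β : ℝ)⁻¹)
  refine IntegrableOn.congr_fun h (fun u hu => ?_) measurableSet_Ioi
  rw [Real.rpow_add hu, Real.rpow_natCast, smul_eq_mul, mul_inv]
  ring

/-- Even `k` give the Kummer series with lower parameter `1/2`, odd `k` the one with `3/2`. The
duplication formula for `Γ(β/2) Γ(β/2 + 1/2)` matches the coefficients, and the factor `e^{x²/(4t)}`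
cancels the Gaussian inside `D`. -/
theorem hasSum_rieszGaussianMoment {β t : ℝ} (hβ : 0 < β) (ht : 0 < t) (x : ℝ) :
    HasSum (fun k => (-x) ^ k * rieszGaussianMoment β t k) (powerParabolicCylinder (-β) x t) := by
  have ht2 : 0 < t / 2 := by positivity
  have hΓ := (Real.Gamma_pos_of_pos hβ).ne'
  have hβ2 : 0 < β / 2 := by positivity
  have hβ3 : 0 < β / 2 + 1 / 2 := by positivity
  have hΓ2 := (Real.Gamma_pos_of_pos hβ2).ne'
  have hΓ3 := (Real.Gamma_pos_of_pos hβ3).ne'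
  have hdup := Real.Gamma_mul_Gamma_add_half (β / 2)
  rw [mul_div_cancel₀ β two_ne_zero] at hdup
  have hpow : ∀ m : ℕ, (t / 2) ^ (-(m : ℝ)) * (x ^ 2) ^ m = 4 ^ m * (x ^ 2 / (2 * t)) ^ m := by
    intro m
    rw [Real.rpow_neg ht2.le, Real.rpow_natCast, ← inv_pow, ← mul_pow, ← mul_pow]
    congr 1
    field_simp
    ring
  have hbase : (t / 2) ^ (-β / 2) = t ^ (-β / 2) * 2 ^ (-β / 2) * 2 ^ β := by
    rw [Real.div_rpow ht.le two_pos.le, mul_assoc, ← Real.rpow_add two_pos, div_eq_mul_inv,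
      ← Real.rpow_neg two_pos.le]
    ring_nf
  have hsqrt : (t / 2) ^ (-(1 / 2) : ℝ) = √2 / √t := by
    rw [Real.rpow_neg ht2.le, ← Real.sqrt_eq_rpow, Real.sqrt_div ht.le, inv_div]
  have h2 : (2 : ℝ) ^ β * 2 ^ (1 - β) = 2 := by
    rw [← Real.rpow_add two_pos, add_sub_cancel, Real.rpow_one]
  have e : powerParabolicCylinder (-β) x t =
      (t ^ (-β / 2) * 2 ^ (-β / 2)) * (√Real.pi * (Real.Gamma (β / 2 + 1 / 2))⁻¹) *
        kummerM (β / 2) (1 / 2) (x ^ 2 / (2 * t)) +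
      -x * (√2 / √t) * ((t ^ (-β / 2) * 2 ^ (-β / 2)) * (√Real.pi * (Real.Gamma (β / 2))⁻¹)) *
        kummerM (β / 2 + 1 / 2) (3 / 2) (x ^ 2 / (2 * t)) := by
    have hz : (x / √t) ^ 2 = x ^ 2 / t := by rw [div_pow, Real.sq_sqrt ht.le]
    unfold powerParabolicCylinder parabolicCylinderD
    rw [hz, Real.sqrt_mul (by norm_num : (0 : ℝ) ≤ 2), show (1 - -β) / 2 = β / 2 + 1 / 2 by ring,
      neg_neg, show 1 / 2 - -β / 2 = β / 2 + 1 / 2 by ring,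
      show x ^ 2 / t / 2 = x ^ 2 / (2 * t) by field_simp,
      show -(x ^ 2 / t) / 4 = -(x ^ 2 / (4 * t)) by field_simp, Real.exp_neg]
    have := (Real.exp_pos (x ^ 2 / (4 * t))).ne'
    field_simp
    ring
  rw [e]
  have hA : (t / 2) ^ (-β / 2) * (1 / 2) * Real.Gamma (β / 2) / Real.Gamma β =
      (t ^ (-β / 2) * 2 ^ (-β / 2)) * (√Real.pi * (Real.Gamma (β / 2 + 1 / 2))⁻¹) := by
    rw [hbase, div_eq_iff hΓ]
    generalize t ^ (-β / 2) * 2 ^ (-β / 2) = p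
    linear_combination p * (1 / 2) * 2 ^ β * (Real.Gamma (β / 2 + 1 / 2))⁻¹ * hdup +
      p * (1 / 2) * Real.Gamma β * √Real.pi * (Real.Gamma (β / 2 + 1 / 2))⁻¹ * h2 -
      p * 2 ^ β * (1 / 2) * Real.Gamma (β / 2) * mul_inv_cancel₀ hΓ3
  have hB : (t / 2) ^ (-β / 2) * (1 / 2) * Real.Gamma (β / 2 + 1 / 2) / Real.Gamma β =
      (t ^ (-β / 2) * 2 ^ (-β / 2)) * (√Real.pi * (Real.Gamma (β / 2))⁻¹) := by
    rw [hbase, div_eq_iff hΓ]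
    generalize t ^ (-β / 2) * 2 ^ (-β / 2) = p
    linear_combination p * (1 / 2) * 2 ^ β * (Real.Gamma (β / 2))⁻¹ * hdup +
      p * (1 / 2) * Real.Gamma β * √Real.pi * (Real.Gamma (β / 2))⁻¹ * h2 -
      p * 2 ^ β * (1 / 2) * Real.Gamma (β / 2 + 1 / 2) * mul_inv_cancel₀ hΓ2
  refine HasSum.even_add_odd ?_ ?_
  · refine ((summable_kummerM (β / 2) (x ^ 2 / (2 * t)) (b := 1 / 2)
      (by norm_num)).hasSum.mul_left _).congr_fun fun m => ?_
    have hp : (ascPochhammer ℝ m).eval (1 / 2 : ℝ) ≠ 0 := (ascPochhammer_pos m _ (by norm_num)).ne'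
    have hf : (m.factorial : ℝ) ≠ 0 := by exact_mod_cast m.factorial_ne_zero
    have e1 : -(β + (2 * m : ℕ)) / 2 = -β / 2 + -(m : ℝ) := by push_cast; ring
    have e2 : (β + (2 * m : ℕ)) / 2 = β / 2 + (m : ℝ) := by push_cast; ring
    rw [rieszGaussianMoment, e1, e2, Real.rpow_add ht2, two_mul_factorial_eq_ascPochhammer,
      Real.Gamma_add_nat_eq_mul_ascPochhammer hβ2, pow_mul, neg_sq, ← hA]
    field_simp
    linear_combination (ascPochhammer ℝ m).eval (β / 2) * hpow m
  · refine ((summable_kummerM (β / 2 + 1 / 2) (x ^ 2 / (2 * t)) (b := 3 / 2)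
      (by norm_num)).hasSum.mul_left _).congr_fun fun m => ?_
    have hp : (ascPochhammer ℝ m).eval (3 / 2 : ℝ) ≠ 0 := (ascPochhammer_pos m _ (by norm_num)).ne'
    have hf : (m.factorial : ℝ) ≠ 0 := by exact_mod_cast m.factorial_ne_zero
    have e1 : -(β + (2 * m + 1 : ℕ)) / 2 = -β / 2 + -(1 / 2) + -(m : ℝ) := by push_cast; ring
    have e2 : (β + (2 * m + 1 : ℕ)) / 2 = β / 2 + 1 / 2 + (m : ℝ) := by push_cast; ring
    rw [rieszGaussianMoment, e1, e2, Real.rpow_add ht2, Real.rpow_add ht2, hsqrt,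
      two_mul_add_one_factorial_eq_ascPochhammer,
      Real.Gamma_add_nat_eq_mul_ascPochhammer hβ3, pow_succ, pow_mul, neg_sq, ← hB]
    have : √t ≠ 0 := (Real.sqrt_pos.2 ht).ne'
    generalize (ascPochhammer ℝ m).eval (β / 2 + 1 / 2) = p
    field_simp
    linear_combination (-x) * p * hpow m

theorem integral_exp_rieszMeasure {β t : ℝ} (hβ : 0 < β) (ht : 0 < t) (x : ℝ) :
    ∫ u, Real.exp (-x * u - t / 2 * u ^ 2) ∂rieszMeasure β = powerParabolicCylinder (-β) x t := by
  let F : ℕ → ℝ → ℝ := fun k u =>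
    (-x) ^ k * (u ^ k / k.factorial * Real.exp (-(t / 2) * u ^ 2))
  have hF : ∀ k, Integrable (F k) (rieszMeasure β) := fun k =>
    (integrable_pow_mul_gaussian_rieszMeasure hβ ht k).const_mul _
  -- Writing `|x|` as `-(-|x|)` presents the series of norms as the moment series at `-|x|`, already
  -- known to converge; this justifies termwise integration.
  have hn : ∀ k, ∫ u, ‖F k u‖ ∂rieszMeasure β = (-(-|x|)) ^ k * rieszGaussianMoment β t k := by
    intro k
    rw [← integral_pow_mul_gaussian_rieszMeasure hβ ht k, ← integral_const_mul]
    refine integral_rieszMeasure_congr β fun u hu => ?_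
    simp only [F]
    rw [norm_mul, norm_pow, norm_neg, Real.norm_eq_abs, neg_neg,
      Real.norm_of_nonneg (by positivity)]
  have h := hasSum_integral_of_summable_integral_norm hF (by
    simp_rw [hn]
    exact (hasSum_rieszGaussianMoment hβ ht (-|x|)).summable)
  have hs : ∀ u, ∑' k, F k u = Real.exp (-x * u - t / 2 * u ^ 2) := by
    intro u
    have h1 := (NormedSpace.expSeries_div_hasSum_exp (-x * u)).mul_right
      (Real.exp (-(t / 2) * u ^ 2))
    rw [← Real.exp_eq_exp_ℝ, ← Real.exp_add] at h1
    rw [sub_eq_add_neg, ← neg_mul, ← h1.tsum_eq]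
    refine tsum_congr fun k => ?_
    simp only [F]
    rw [mul_pow]
    ring
  simp_rw [hs] at h
  refine h.unique ?_
  have he : ∀ k, ∫ u, F k u ∂rieszMeasure β = (-x) ^ k * rieszGaussianMoment β t k := fun k => by
    rw [← integral_pow_mul_gaussian_rieszMeasure hβ ht k, ← integral_const_mul]
  simp_rw [he]
  exact hasSum_rieszGaussianMoment hβ ht x

/-! ### The main formula -/

/-- Differentiating the Gaussian produces `-(x + tu)`, and the factor `u` lowers the order by one.
The parameter `β` stays free in the induction because that term is the case `β + 1` with the same
`n`. -/
theorem rieszDist_cutoff_mul_gaussian (x : ℝ) {t : ℝ} (ht : 0 < t) (n : ℕ) :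
    ∀ {β : ℝ} (hβ : 0 < β) (ψ : 𝓢(ℝ, ℂ)),
      (∀ u : ℝ, 0 < u → ψ u = Complex.exp (-u * x - u ^ 2 * t / 2)) →
      rieszDist hβ n ψ = powerParabolicCylinder (n - β) x t := by
  induction n with
  | zero =>
    intro β hβ ψ hψ
    rw [rieszDist_zero_apply, Nat.cast_zero, zero_sub, ← integral_exp_rieszMeasure hβ ht x,
      ← integral_complex_ofReal]
    refine integral_rieszMeasure_congr β fun u hu => ?_
    rw [hψ u hu, Complex.ofReal_exp]
    congr 1
    push_cast
    ring
  | succ n ih =>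
    intro β hβ ψ hψ
    have hβ' : 0 < β + 1 := by linarith
    have hid : (fun u : ℝ => (u : ℂ)).HasTemperateGrowth := Complex.ofRealCLM.hasTemperateGrowth
    let Θ : 𝓢(ℝ, ℂ) := SchwartzMap.smulLeftCLM ℂ (fun u : ℝ => (u : ℂ)) ψ
    have hΘ : ∀ u, Θ u = u * ψ u := fun u => by
      simp only [Θ]
      rw [SchwartzMap.smulLeftCLM_apply_apply hid, smul_eq_mul]
    have h1 : rieszDist hβ n (SchwartzMap.derivCLM ℂ ℂ ψ) =
        rieszDist hβ n (-((x : ℂ) • ψ + (t : ℂ) • Θ)) := by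
      refine rieszDist_congr hβ n fun u hu => ?_
      have e1 : HasDerivAt (fun u : ℝ => Complex.exp (-u * x - u ^ 2 * t / 2))
          (Complex.exp (-u * x - u ^ 2 * t / 2) * (-1 * x - 2 * u * t / 2)) u := by
        have h2 : HasDerivAt (fun u : ℝ => (u : ℂ)) 1 u := Complex.ofRealCLM.hasDerivAt
        have h3 : HasDerivAt (fun u : ℝ => (u : ℂ) ^ 2) (2 * u) u := by
          simpa using h2.fun_pow 2
        exact ((h2.fun_neg.mul_const (x : ℂ)).fun_sub ((h3.mul_const (t : ℂ)).div_const 2)).cexp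
      rw [SchwartzMap.derivCLM_apply, Filter.EventuallyEq.deriv_eq
        (Filter.eventually_of_mem (Ioi_mem_nhds hu) hψ), e1.deriv, neg_apply, add_apply,
        smul_apply, smul_apply, hΘ, hψ u hu, smul_eq_mul, smul_eq_mul]
      ring
    rw [rieszDist_succ_apply, h1, map_neg, map_add, map_smul, map_smul,
      rieszDist_mul_id hβ hβ' n ψ Θ fun u _ => hΘ u, ih hβ ψ hψ, ih hβ' ψ hψ,
      show ((n + 1 : ℕ) : ℝ) - β = (n - β) + 1 by push_cast; ring,
      powerParabolicCylinder_add_one _ x ht, show (n : ℝ) - (β + 1) = n - β - 1 by ring,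
      smul_eq_mul, smul_eq_mul]
    push_cast
    ring

theorem integral_exp_neg_mul_of_isBrownianReal {Ω : Type*} [MeasurableSpace Ω] {P : Measure Ω}
    {W : ℝ≥0 → Ω → ℝ} (hW : IsBrownianReal W P) (t : ℝ≥0) (u : ℝ) :
    ∫ w, Real.exp (-u * W t w) ∂P = Real.exp (t / 2 * u ^ 2) := by
  have h := mgf_gaussianReal (hW.toIsPreBrownianReal.hasLaw_eval t).map_eq (-u)
  rw [mgf] at h
  rw [h]
  ring_nf

/-- The Laplace transform at `x` of `e^{-tu²/2} g(u)` is `⟨g(u), e^{-ux-u²t/2}⟩`. -/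
theorem hasLaplace_gaussian_mul {T : 𝓢'(ℝ, ℂ)} {g : DistR} (hT : Extends T g) (hg : g ∈ DPlus)
    {a x t : ℝ} (ht : 0 < t) (hax : a < x) {Φ : 𝓢(ℝ, ℂ)}
    (hΦ : ∀ u : ℝ, Φ u = cutoff u * Complex.exp (-u * x - u ^ 2 * t / 2)) :
    HasLaplace a (distMul (fun u => Real.exp (-(t / 2 * u ^ 2))) g) x (T Φ) := by
  have hm₂ : ContDiff ℝ ∞ fun u : ℝ => Real.exp (-(t / 2 * u ^ 2)) :=
    Real.contDiff_exp.comp (contDiff_const.mul (contDiff_id.pow 2)).neg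
  -- The Gaussian factor dominates `e^{-ξu}` for every real `ξ`, which is why `a` may be any number
  -- below `x`, negative ones included.
  have hm : ∀ ξ : ℝ, (fun u => (cutoff u : ℂ) *
      (Real.exp (-ξ * u) * Real.exp (-(t / 2 * u ^ 2)) : ℝ)).HasTemperateGrowth := fun ξ => by
    simpa only [← Real.exp_add, ← sub_eq_add_neg] using
      exp_neg_mul_cutoff_hasTemperateGrowth (ξ := ξ) (c := t / 2) (Or.inl (by positivity))
  refine ⟨⟨distMul_mem_DPlus hm₂ hg, fun ξ _ => ?_⟩, by simpa using hax, fun ξ _ hξ => ?_⟩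
  · rw [distMul_distMul (contDiff_exp_mul _) hm₂]
    exact distMul_mem_SPlus ⟨hg, T, hT⟩ ((contDiff_exp_mul _).mul hm₂) (hm ξ)
  · rw [distMul_distMul (contDiff_exp_mul _) hm₂]
    obtain ⟨ψ, hψ⟩ := exists_schwartz_cutoff_mul_exp (x - ξ) 0
      (Or.inr ⟨rfl, by simpa using hξ⟩)
    refine hasPairing_distMul hT hg ((contDiff_exp_mul _).mul hm₂) (hm ξ)
      ⟨ψ, fun u => by rw [hψ]; simp⟩ fun u hu => ?_
    rw [hΦ, cutoff_eq_one hu.le, ← Real.exp_add, Complex.ofReal_exp, ← Complex.exp_add,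
      Complex.ofReal_one, one_mul]
    congr 1
    push_cast
    ring

theorem mainTheorem1 (α : ℝ) :
    (∃! g : DistR, IsInverseLaplace 0 (fun s : ℂ => s ^ (α : ℂ)) g) ∧
    ∀ g : DistR, IsInverseLaplace 0 (fun s : ℂ => s ^ (α : ℂ)) g →
      ∀ (t : ℝ≥0) (x : ℝ), 0 < t →
        (∀ (Ω : Type*) [MeasurableSpace Ω] (P : Measure Ω) [IsProbabilityMeasure P]
            (W : ℝ≥0 → Ω → ℝ), IsBrownianReal W P →
            ∀ a : ℝ, a < x →
              HasAppell a (W t) P g (x : ℂ) (powerParabolicCylinder α x t : ℂ)) ∧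
        HasPairing g (fun u : ℝ => Complex.exp (-u * x - u ^ 2 * t / 2))
          (powerParabolicCylinder α x t : ℂ) := by
  obtain ⟨n, hn⟩ := exists_nat_gt α
  have hβ : 0 < n - α := sub_pos.2 hn
  have h₀ : IsInverseLaplace 0 (fun s : ℂ => s ^ (α : ℂ)) (restrictDist (rieszDist hβ n)) := by
    have := isInverseLaplace_rieszDist hβ n
    simpa using this
  refine ⟨⟨_, h₀, fun g hg => hg.unique h₀⟩, fun g hg t x ht => ?_⟩
  -- By uniqueness the claims need checking only for the explicit distribution.
  obtain rfl := hg.unique h₀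
  have ht' : (0 : ℝ) < t := ht
  have hE := extends_restrictDist (rieszDist hβ n)
  have hD := restrictDist_rieszDist_mem_DPlus hβ n
  obtain ⟨Φ, hΦ⟩ := exists_schwartz_cutoff_mul_exp x (t / 2) (Or.inl (by positivity))
  have hΦ' : ∀ u : ℝ, Φ u = cutoff u * Complex.exp (-u * x - u ^ 2 * (t : ℝ) / 2) := fun u => by
    rw [hΦ]
    congr 2
    push_cast
    ring
  have hv : rieszDist hβ n Φ = powerParabolicCylinder α x t := by
    rw [rieszDist_cutoff_mul_gaussian x ht' n hβ Φ fun u hu => ?_, sub_sub_cancel]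
    rw [hΦ', cutoff_eq_one (by linarith), Complex.ofReal_one, one_mul]
  rw [← hv]
  refine ⟨fun Ω _ P _ W hW a ha => ?_, hasPairing_of_extends hE hD hΦ'⟩
  have hW' := integral_exp_neg_mul_of_isBrownianReal hW t
  have hinv : (fun u : ℝ => (∫ w, Real.exp (-u * W t w) ∂P)⁻¹) =
      fun u => Real.exp (-(t / 2 * u ^ 2)) := by
    ext u
    rw [hW', Real.exp_neg]
  refine ⟨fun u => ?_, ?_, ?_⟩
  -- A non-integrable function has Bochner integral `0`, whereas this integral is a positive
  -- exponential.
  · by_contra hc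
    have := hW' u
    rw [integral_undef hc] at this
    exact (Real.exp_pos _).ne this
  · rw [hinv]
    exact Real.contDiff_exp.comp (contDiff_const.mul (contDiff_id.pow 2)).neg
  · rw [hinv]
    exact hasLaplace_gaussian_mul hE hD ht' ha hΦ'
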